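/- \textbf{Setting.} Let $\mathbb X,\mathbb U,\mathbb K$ be separable real Hilbert spaces, $\tau>0$, $\rho>0$. Let $\mathcal A$ with domain $D(\mathcal A)$ generate a strongly continuous semigroup $\mathcal T(t)$ on $\mathbb X$. Let $\mathcal F:\mathbb X\to\mathbb X$ be Gâteaux differentiable with derivatives $\mathcal F'_x\in\mathcal L(\mathbb X)$, where $x\mapsto\mathcal F'_x$ maps bounded sets to bounded sets. Let $K_{ad}\subset\mathbb K$, and let $\mathcal B:K_{ad}\to\mathcal L(\mathbb U,\mathbb X)$ be Gâteaux differentiable on $K_{ad}$ with derivatives $\mathcal B'_r\in\mathcal L(\mathbb K,\mathcal L(\mathbb U,\mathbb X))$, where $r\mapsto\mathcal B'_r$ maps bounded subsets of $K_{ad}$ to bounded sets. Let $\mathcal Q\in\mathcal L(\mathbb X)$ be self-adjoint and positive semi-definite, and let $\mathcal R\in\mathcal L(\mathbb U)$ be self-adjoint and positive definite, in the sense that $\langle \mathcal Rv,v\rangle\ge c\|v\|^2$ for all $v \in \mathbb U$ and some $c>0$ (so $\mathcal R$ is boundedly invertible). Put $U_{ad}=\{u\in L^2(0,\tau;\mathbb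 U):\|u\|_{2}\le\rho\}$. For $\xi\in\mathbb X$, $u\in U_{ad}$, $r\in K_{ad}$, a mild solution of the state equation is $x\in C([0,\tau];\mathbb X)$ with $$x(t)=\mathcal T(t)\xi+\int_0^t\mathcal T(t-s)\mathcal F(x(s))\,ds+\int_0^t\mathcal T(t-s)\mathcal B(r)u(s)\,ds,\qquad t\in[0,\tau].$$ The problem is to minimize $J=\int_0^\tau\langle\mathcal Qx(t),x(t)\rangle+\langle\mathcal Ru(t),u(t)\rangle\,dt$ over $(u,r)\in U_{ad}\times K_{ad}$, $x$ being a mild solution for $(u,r)$ with initial condition $\xi$; local minimizers are understood in $L^2(0,\tau;\mathbb U)\times\mathbb K$. If $x^o$ is the trajectory of $(u^o,r^o)$, the adjoint state $p^o$ is the mild solution of $\dot p^o=-(\mathcal A^*+\mathcal F'^*_{x^o(t)})p^o-\mathcal Qx^o$, $p^o(\tau)=0$, i.e. $p^o\in C([0,\tau];\mathbb X)$ and $$p^o(s)=\int_s^\tau \mathcal T(t-s)^*\big(\mathcal F'^*_{x^o(t)}p^o(t)+\mathcal Qx^o(t)\big)\,dt,\qquad s\in[0,\tau].$$ Let $(e^{\mathbb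 X}_k)$, $(e^{\mathbb U}_i)$, $(e^{\mathbb K}_j)$ be (finite or countable) orthonormal bases of $\mathbb X,\mathbb U,\mathbb K$; put $b_i(r)=\mathcal B(r)e^{\mathbb U}_i$, $u^o_i(t)=\langle u^o(t),e^{\mathbb U}_i\rangle$, $p^o_k(t)=\langle p^o(t),e^{\mathbb X}_k\rangle$. For $v\in\mathbb U$ let $(\mathcal B'_{r}v)^*:\mathbb X\to\mathbb K$ be the adjoint of $h\mapsto(\mathcal B'_{r}h)v$. \textbf{Corollary.} (i) $\mathcal B(r)v=\sum_i\langle v,e^{\mathbb U}_i\rangle b_i(r)$ for all $r\in K_{ad}$, $v\in\mathbb U$. Let now $(u^o,r^o)$ be an interior point of $U_{ad}\times K_{ad}$. (ii) Every $b_i$ is Gâteaux differentiable at $r^o$, with derivative $b'_{i,r^o}h=(\mathcal B'_{r^o}h)e^{\mathbb U}_i$. (iii) For every $p^o\in C([0,\tau];\mathbb X)$, the optimality condition $$u^o(t)=-\mathcal R^{-1}\mathcal B^*(r^o)p^o(t)\quad\text{for a.e. }t\in(0,\tau)$$ is equivalent to $$u^o_j(t)+\sum_i\sum_k\langle b_i(r^o),e^{\mathbb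 X}_k\rangle\langle\mathcal R^{-1}e^{\mathbb U}_i,e^{\mathbb U}_j\rangle\,p^o_k(t)=0\quad\text{for each }j\text{ and a.e. }t\in(0,\tau),\tag{1}$$ and the optimality condition $\int_0^\tau(\mathcal B'_{r^o}u^o(t))^*p^o(t)\,dt=0$ is equivalent to $$\sum_i\sum_k\langle b'_{i,r^o}e^{\mathbb K}_j,e^{\mathbb X}_k\rangle\int_0^\tau u^o_i(s)p^o_k(s)\,ds=0\quad\text{for each }j.\tag{2}$$ Here (1) and (2) include the convergence of the iterated series (of each inner series over $k$, and of the outer series over $i$). (iv) If $(u^o,r^o)$ is a local minimizer, for some initial condition $\xi\in\mathbb X$, with trajectory $x^o$ and adjoint state $p^o$, then (1) and (2) hold. -/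

import Mathlib

open MeasureTheory Set Filter Topology
open scoped InnerProductSpace

noncomputable section

namespace ActuatorDesign

variable {X U K : Type*}
  [NormedAddCommGroup X] [InnerProductSpace ℝ X] [CompleteSpace X]
  [NormedAddCommGroup U] [InnerProductSpace ℝ U] [CompleteSpace U]
  [NormedAddCommGroup K] [InnerProductSpace ℝ K] [CompleteSpace K]

/-- A strongly continuous semigroup `(T t)_{t ≥ 0}` of bounded operators on `X`.
(The values of `toFun` at negative times carry no information and are never used.) -/
structure C0Semigroup (X : Type*) [NormedAddCommGroup X] [InnerProductSpace ℝ X] where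
  toFun : ℝ → X →L[ℝ] X
  map_zero : toFun 0 = ContinuousLinearMap.id ℝ X
  map_add : ∀ s t : ℝ, 0 ≤ s → 0 ≤ t → toFun (s + t) = (toFun s).comp (toFun t)
  strongly_continuous : ∀ x : X, ContinuousOn (fun t => toFun t x) (Ici 0)

/-- The (unbounded) operator `A` with domain `D(A) = A.domain` is the infinitesimal generator of
`T`: `x ∈ D(A)` and `A x = y` if and only if `(T h x - x) / h → y` as `h ↓ 0`. -/
def IsGenerator (A : X →ₗ.[ℝ] X) (T : C0Semigroup X) : Prop :=
  ∀ x y : X, (x, y) ∈ A.graph ↔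
    Tendsto (fun h : ℝ => h⁻¹ • (T.toFun h x - x)) (𝓝[>] 0) (𝓝 y)

/-- `f` is Gâteaux differentiable on `s`, with Gâteaux derivative `f' x` (a bounded linear map) at
each `x ∈ s`. Only increments that stay in `s` are used, so that only the values of `f` on `s`
matter; at interior points of `s` this is the usual Gâteaux derivative. -/
def IsGateauxDerivOn {E G : Type*} [NormedAddCommGroup E] [NormedSpace ℝ E]
    [NormedAddCommGroup G] [NormedSpace ℝ G] (f : E → G) (f' : E → E →L[ℝ] G) (s : Set E) : Prop :=
  ∀ x ∈ s, ∀ h : E, HasLineDerivWithinAt ℝ f (f' x h) s x h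

/-- `g` maps bounded subsets of `s` to bounded sets. -/
def MapsBoundedToBounded {E G : Type*} [Bornology E] [Bornology G] (g : E → G) (s : Set E) :
    Prop :=
  ∀ S ⊆ s, Bornology.IsBounded S → Bornology.IsBounded (g '' S)

/-- Self-adjoint positive definite bounded operators, with positive definiteness in the uniform
sense (the one that makes the operator boundedly invertible on a Hilbert space). -/
def IsPosDef (R : U →L[ℝ] U) : Prop :=
  IsSelfAdjoint R ∧ ∃ c : ℝ, 0 < c ∧ ∀ v : U, c * ‖v‖ ^ 2 ≤ ⟪R v, v⟫_ℝ

/-- The control space `L²(0, τ; U)`. -/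
abbrev Control (τ : ℝ) (U : Type*) [NormedAddCommGroup U] [InnerProductSpace ℝ U] : Type _ :=
  Lp U 2 (volume.restrict (Ioc (0 : ℝ) τ))

/-- The admissible controls: the closed ball of radius `ρ` of `L²(0, τ; U)`. -/
def admissibleControls (τ ρ : ℝ) (U : Type*) [NormedAddCommGroup U] [InnerProductSpace ℝ U] :
    Set (Control τ U) :=
  {u | ‖u‖ ≤ ρ}

/-- `x ∈ C([0, τ]; X)` is the mild solution of `x' = A x + F(x) + G u`, `x(0) = x₀`, where `T` is
the semigroup generated by `A`. -/
def IsMildSolution (T : C0Semigroup X) (F : X → X) (G : U →L[ℝ] X) {τ : ℝ} (u : Control τ U)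
    (x₀ : X) (x : ℝ → X) : Prop :=
  ContinuousOn x (Icc 0 τ) ∧
  ∀ t ∈ Icc 0 τ, x t = T.toFun t x₀ + (∫ s in (0 : ℝ)..t, T.toFun (t - s) (F (x s)))
    + ∫ s in (0 : ℝ)..t, T.toFun (t - s) (G (u s))

/-- `p ∈ C([0, τ]; X)` is the mild solution of the final value problem
`p' = -(A* + F'(x)*) p - Q x`, `p(τ) = 0`; the semigroup generated by `A*` is `T(t)*`. -/
def IsAdjointState (T : C0Semigroup X) (F' : X → X →L[ℝ] X) (Q : X →L[ℝ] X) (τ : ℝ)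
    (x p : ℝ → X) : Prop :=
  ContinuousOn p (Icc 0 τ) ∧
  ∀ s ∈ Icc 0 τ, p s = ∫ t in s..τ, ContinuousLinearMap.adjoint (T.toFun (t - s))
    (ContinuousLinearMap.adjoint (F' (x t)) (p t) + Q (x t))

/-- The quadratic cost `∫₀^τ ⟨Q x, x⟩ + ⟨R u, u⟩ dt`. -/
def cost (Q : X →L[ℝ] X) (R : U →L[ℝ] U) {τ : ℝ} (x : ℝ → X) (u : Control τ U) : ℝ :=
  ∫ t in (0 : ℝ)..τ, (⟪Q (x t), x t⟫_ℝ + ⟪R (u t), u t⟫_ℝ)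

/-- `(u₀, r₀)`, with trajectory `x₀`, is a local minimizer (in `L²(0, τ; U) × K`) of the cost over
the admissible pairs `(u, r)`, subject to the state equation with initial condition `ξ`. -/
def IsLocalMinimizer (T : C0Semigroup X) (F : X → X) (B : K → U →L[ℝ] X) (Q : X →L[ℝ] X)
    (R : U →L[ℝ] U) (Kad : Set K) {τ : ℝ} (ρ : ℝ) (ξ : X)
    (u₀ : Control τ U) (r₀ : K) (x₀ : ℝ → X) : Prop :=
  (u₀, r₀) ∈ admissibleControls τ ρ U ×ˢ Kad ∧
  IsMildSolution T F (B r₀) u₀ ξ x₀ ∧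
  ∀ᶠ z : Control τ U × K in 𝓝[admissibleControls τ ρ U ×ˢ Kad] (u₀, r₀),
    ∀ x : ℝ → X, IsMildSolution T F (B z.2) z.1 ξ x → cost Q R x₀ u₀ ≤ cost Q R x z.1

/-- First optimality condition: `u(t) = -R⁻¹ B*(r) p(t)` for almost every `t ∈ (0, τ)`. -/
def ControlCondition (B : K → U →L[ℝ] X) (R : U →L[ℝ] U) {τ : ℝ}
    (u : Control τ U) (r : K) (p : ℝ → X) : Prop :=
  ∀ᵐ t ∂(volume.restrict (Ioc 0 τ)),
    u t = -(R.inverse (ContinuousLinearMap.adjoint (B r) (p t)))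

/-- Second optimality condition: `∫₀^τ (B'_r u(t))* p(t) dt = 0`, where, for `v ∈ U`,
`(B'_r v)* : X → K` is the adjoint of the bounded linear map `h ↦ (B'_r h) v`. -/
def ActuatorCondition (B' : K → K →L[ℝ] (U →L[ℝ] X)) {τ : ℝ}
    (u : Control τ U) (r : K) (p : ℝ → X) : Prop :=
  ∫ t in (0 : ℝ)..τ, ContinuousLinearMap.adjoint ((B' r).flip (u t)) (p t) = 0

/-- The vectors `b_i(r) = B(r) e_i`, the coefficients in the expansion
`B(r) v = ∑ i, ⟨v, e_i⟩ b_i(r)`. -/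
def inputVec {ιU : Type*} (B : K → U →L[ℝ] X) (eU : HilbertBasis ιU ℝ U) (i : ιU) (r : K) : X :=
  B r (eU i)

/-- The Gâteaux derivative `b'_{i,r} h` of `b_i` at `r` in the direction `h`. -/
def inputVecDeriv {ιU : Type*} (B : K → U →L[ℝ] X) (eU : HilbertBasis ιU ℝ U) (i : ιU) (r h : K) :
    X :=
  lineDeriv ℝ (inputVec B eU i) r h

/-- The iterated series `∑ i, ∑ k, a i k` converges (every inner series and the outer one). -/
def DoubleSummable {ι κ : Type*} (a : ι → κ → ℝ) : Prop :=
  (∀ i, Summable (a i)) ∧ Summable fun i => ∑' k, a i k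

/-- The first optimality condition in components: for almost every `t ∈ (0, τ)` and each `j`,
`u_j(t) + ∑ i, ∑ k, ⟨b_i(r), e_k⟩ ⟨R⁻¹ e_i, e_j⟩ p_k(t) = 0`, with convergence of the series. -/
def ControlConditionComponents {ιX ιU : Type*} (B : K → U →L[ℝ] X) (R : U →L[ℝ] U)
    (eX : HilbertBasis ιX ℝ X) (eU : HilbertBasis ιU ℝ U) {τ : ℝ}
    (u : Control τ U) (r : K) (p : ℝ → X) : Prop :=
  ∀ᵐ t ∂(volume.restrict (Ioc 0 τ)), ∀ j : ιU,
    DoubleSummable (fun (i : ιU) (k : ιX) =>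
      ⟪inputVec B eU i r, eX k⟫_ℝ * ⟪R.inverse (eU i), eU j⟫_ℝ * ⟪p t, eX k⟫_ℝ) ∧
    ⟪u t, eU j⟫_ℝ + ∑' i : ιU, ∑' k : ιX,
      ⟪inputVec B eU i r, eX k⟫_ℝ * ⟪R.inverse (eU i), eU j⟫_ℝ * ⟪p t, eX k⟫_ℝ = 0

/-- The second optimality condition in components: for each `j`,
`∑ i, ∑ k, ⟨b'_{i,r} e_j, e_k⟩ ∫₀^τ u_i(s) p_k(s) ds = 0`, with convergence of the series. -/
def ActuatorConditionComponents {ιX ιU ιK : Type*} (B : K → U →L[ℝ] X)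
    (eX : HilbertBasis ιX ℝ X) (eU : HilbertBasis ιU ℝ U) (eK : HilbertBasis ιK ℝ K) {τ : ℝ}
    (u : Control τ U) (r : K) (p : ℝ → X) : Prop :=
  ∀ j : ιK,
    DoubleSummable (fun (i : ιU) (k : ιX) =>
      ⟪inputVecDeriv B eU i r (eK j), eX k⟫_ℝ *
        ∫ s in (0 : ℝ)..τ, ⟪u s, eU i⟫_ℝ * ⟪p s, eX k⟫_ℝ) ∧
    ∑' i : ιU, ∑' k : ιX, ⟪inputVecDeriv B eU i r (eK j), eX k⟫_ℝ *
        ∫ s in (0 : ℝ)..τ, ⟪u s, eU i⟫_ℝ * ⟪p s, eX k⟫_ℝ = 0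

end ActuatorDesign

end

noncomputable section

set_option linter.unusedSectionVars false

namespace ActuatorDesign

variable {X U K : Type*}
  [NormedAddCommGroup X] [InnerProductSpace ℝ X] [CompleteSpace X]
  [NormedAddCommGroup U] [InnerProductSpace ℝ U] [CompleteSpace U]
  [NormedAddCommGroup K] [InnerProductSpace ℝ K] [CompleteSpace K]

/-! The componentwise conditions come from Parseval's identity. At fixed `t`, testing `u + R⁻¹B*p =
0` against `e_j` and expanding in `U` and then in `X` gives the first one
(`controlCondition_iff_components`). For the second, the `e_j`-component of the integral is `∫ ⟨p,
(B'e_j)u⟩`. Its expansion in `U` may be integrated termwise, because the terms are dominated by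
squares of coordinates whose sum is integrable (`hasSum_integral_inner_mul_inner`).

Necessity is a first-order variation. Along `(u₀ + εv, r₀ + εh)` the state exists for small `ε > 0`
and equals `x₀ + εy + o(ε)` uniformly in time, where `y` solves the linearised equation
(`exists_perturbed_solution`). There `F` is truncated to a globally Lipschitz map, a fixed point is
taken in a weighted norm, and the remainder is controlled by a Grönwall estimate. Fubini on a
triangle turns `∫ ⟨Qx₀, y⟩` into `∫ ⟨p, g⟩`, with `g` the linearised forcing
(`IsAdjointState.integral_inner_eq`). Dividing the cost increment by `ε` gives
`IsLocalMinimizer.variational_inequality`. Since the pair is interior, `v` and `h` are arbitrary,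
and suitable choices force both conditions. -/

/-! ### Hilbert bases, weak measurability and positive definite operators. -/

theorem _root_.HilbertBasis.countable_of_separableSpace {ι E : Type*} [NormedAddCommGroup E]
    [InnerProductSpace ℝ E] [TopologicalSpace.SeparableSpace E] (b : HilbertBasis ι ℝ E) :
    Countable ι := by
  -- Distinct basis vectors are `√2 > 1` apart, so balls of radius `1/2` around them are disjoint.
  have hd : Pairwise (Function.onFun Disjoint fun i => Metric.ball (b i) (1 / 2)) := by
    intro i j hij
    refine Metric.ball_disjoint_ball ?_
    have h2 : ‖b i - b j‖ ^ 2 = 2 := by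
      rw [@norm_sub_sq_real, b.orthonormal.1 i, b.orthonormal.1 j, b.orthonormal.2 hij]
      norm_num
    rw [dist_eq_norm]
    nlinarith [norm_nonneg (b i - b j)]
  refine hd.countable_of_isOpen_disjoint (fun i => Metric.isOpen_ball) fun i => ?_
  exact ⟨b i, Metric.mem_ball_self (by norm_num)⟩

/-- A Pettis-type criterion: `f` is the pointwise limit of the partial sums of its expansion in a
countable basis. It serves for adjoints of operator families that are only strongly continuous or
strongly measurable, where only the pairings with fixed vectors are accessible. -/
theorem aestronglyMeasurable_of_inner {α E : Type*} [MeasurableSpace α] {μ : Measure α}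
    [NormedAddCommGroup E] [InnerProductSpace ℝ E] [CompleteSpace E]
    [TopologicalSpace.SeparableSpace E] {f : α → E}
    (h : ∀ v, AEStronglyMeasurable (fun a => ⟪v, f a⟫_ℝ) μ) : AEStronglyMeasurable f μ := by
  obtain ⟨w, b, -⟩ := exists_hilbertBasis ℝ E
  have := b.countable_of_separableSpace
  refine aestronglyMeasurable_of_tendsto_ae (atTop : Filter (Finset w))
    (f := fun s a => ∑ i ∈ s, ⟪b i, f a⟫_ℝ • b i) (fun s => ?_) (ae_of_all _ fun a => ?_)
  · exact Finset.aestronglyMeasurable_fun_sum s fun i _ => (h (b i)).smul_const _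
  · have h := b.hasSum_repr (f a)
    simp only [b.repr_apply_apply] at h
    exact h

/-- Coercivity makes `R` a unit. Without this, the total function `R.inverse` could be its default
value `0`. -/
theorem IsPosDef.isInvertible {R : U →L[ℝ] U} (hR : IsPosDef R) : R.IsInvertible := by
  obtain ⟨c, hc, h⟩ := hR.2
  have hu : IsUnit R := by
    refine ContinuousLinearMap.isUnit_of_forall_le_norm_inner_map R (c := ⟨c, hc.le⟩) hc fun x => ?_
    have := (h x).trans (le_abs_self _)
    rw [mul_comm]
    exact this
  exact ⟨ContinuousLinearEquiv.ofUnit hu.unit, rfl⟩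

theorem IsPosDef.map_inverse {R : U →L[ℝ] U} (hR : IsPosDef R) (v : U) :
    R (R.inverse v) = v :=
  (hR.isInvertible.inverse_apply_eq.1 rfl).symm

theorem IsPosDef.inner_map {R : U →L[ℝ] U} (hR : IsPosDef R) (v w : U) :
    ⟪R v, w⟫_ℝ = ⟪v, R w⟫_ℝ :=
  hR.1.isSymmetric v w

theorem IsPosDef.inner_inverse {R : U →L[ℝ] U} (hR : IsPosDef R) (v w : U) :
    ⟪R.inverse v, w⟫_ℝ = ⟪v, R.inverse w⟫_ℝ := by
  conv_lhs => rw [← hR.map_inverse w]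
  rw [← hR.inner_map, hR.map_inverse]

theorem _root_.HilbertBasis.hasSum_inner_mul_inner_real {ι E : Type*} [NormedAddCommGroup E]
    [InnerProductSpace ℝ E] (b : HilbertBasis ι ℝ E) (x y : E) :
    HasSum (fun i => ⟪x, b i⟫_ℝ * ⟪y, b i⟫_ℝ) ⟪x, y⟫_ℝ := by
  simpa only [real_inner_comm] using b.hasSum_inner_mul_inner x y

theorem _root_.HilbertBasis.eq_zero_iff_inner {ι E : Type*} [NormedAddCommGroup E]
    [InnerProductSpace ℝ E] (b : HilbertBasis ι ℝ E) (x : E) :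
    x = 0 ↔ ∀ i, ⟪x, b i⟫_ℝ = 0 := by
  refine ⟨fun h i => by simp [h], fun h => ?_⟩
  have h0 := b.tsum_inner_mul_inner x x
  simpa [h] using h0.symm

/-! ### Componentwise form of the optimality conditions. -/

theorem DoubleSummable.of_hasSum {ι κ : Type*} {a : ι → κ → ℝ} {b : ι → ℝ} {c : ℝ}
    (h : ∀ i, HasSum (a i) (b i)) (hb : HasSum b c) :
    DoubleSummable a ∧ ∑' i, ∑' k, a i k = c := by
  have e : (fun i => ∑' k, a i k) = b := funext fun i => (h i).tsum_eq
  exact ⟨⟨fun i => (h i).summable, e ▸ hb.summable⟩, e ▸ hb.tsum_eq⟩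

theorem hasSum_inner_smul_inputVec {ιU : Type*} (B : K → U →L[ℝ] X) (eU : HilbertBasis ιU ℝ U)
    (r : K) (v : U) : HasSum (fun i => ⟪v, eU i⟫_ℝ • inputVec B eU i r) (B r v) := by
  have := (eU.hasSum_repr v).mapL (B r)
  simp only [map_smul, eU.repr_apply_apply, real_inner_comm] at this
  exact this

/-- The equivalence holds at every single `t`. The inner series is Parseval in `X` for `b_i` and `p
t`; the outer one is Parseval in `U` for `R⁻¹e_j` and `B*p t`, once self-adjointness has moved `R⁻¹`
onto `e_j`. -/
theorem controlCondition_iff_components {ιX ιU : Type*} (B : K → U →L[ℝ] X) {R : U →L[ℝ] U}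
    (hR : IsPosDef R) (eX : HilbertBasis ιX ℝ X) (eU : HilbertBasis ιU ℝ U) {τ : ℝ}
    (u : Control τ U) (r : K) (p : ℝ → X) :
    ControlCondition B R u r p ↔ ControlConditionComponents B R eX eU u r p := by
  refine eventually_congr (Eventually.of_forall fun t => ?_)
  rw [← add_eq_zero_iff_eq_neg, eU.eq_zero_iff_inner]
  refine forall_congr' fun j => ?_
  have h1 : ∀ i, HasSum (fun k => ⟪inputVec B eU i r, eX k⟫_ℝ * ⟪R.inverse (eU i), eU j⟫_ℝ *
      ⟪p t, eX k⟫_ℝ) (⟪R.inverse (eU j), eU i⟫_ℝ *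
        ⟪ContinuousLinearMap.adjoint (B r) (p t), eU i⟫_ℝ) := by
    intro i
    have := (eX.hasSum_inner_mul_inner_real (inputVec B eU i r) (p t)).mul_left
      ⟪R.inverse (eU i), eU j⟫_ℝ
    rw [ContinuousLinearMap.adjoint_inner_left, ← real_inner_comm (R.inverse (eU j)),
      ← hR.inner_inverse, real_inner_comm (B r (eU i))]
    exact this.congr_fun fun k => by ring
  obtain ⟨h2, h3⟩ := DoubleSummable.of_hasSum h1 (eU.hasSum_inner_mul_inner_real _ _)
  rw [h3, inner_add_left, hR.inner_inverse (ContinuousLinearMap.adjoint (B r) (p t)),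
    real_inner_comm (R.inverse (eU j))]
  exact ⟨fun h => ⟨h2, h⟩, fun h => h.2⟩

theorem hasLineDerivAt_inputVec {ιU : Type*} {B : K → U →L[ℝ] X} {B' : K → K →L[ℝ] (U →L[ℝ] X)}
    (eU : HilbertBasis ιU ℝ U) {r h : K} (hB : HasLineDerivAt ℝ B (B' r h) r h) (i : ιU) :
    HasLineDerivAt ℝ (inputVec B eU i) (B' r h (eU i)) r h :=
  (ContinuousLinearMap.apply ℝ X (eU i)).hasFDerivAt.comp_hasDerivAt (0 : ℝ) hB

theorem Control.integrable_norm_sq {τ : ℝ} (u : Control τ U) :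
    Integrable (fun t => ‖u t‖ ^ 2) (volume.restrict (Ioc (0 : ℝ) τ)) :=
  (memLp_two_iff_integrable_sq_norm (Lp.aestronglyMeasurable u)).1 (Lp.memLp u)

theorem Control.integrable {τ : ℝ} (u : Control τ U) :
    Integrable u (volume.restrict (Ioc (0 : ℝ) τ)) :=
  (Lp.memLp u).integrable (by norm_num)

theorem integrable_adjoint_flip {τ : ℝ} (C : K →L[ℝ] (U →L[ℝ] X)) (u : Control τ U) {p : ℝ → X}
    (hp : ContinuousOn p (Icc 0 τ)) :
    Integrable (fun t => ContinuousLinearMap.adjoint (C.flip (u t)) (p t))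
      (volume.restrict (Ioc (0 : ℝ) τ)) := by
  have hpm : AEStronglyMeasurable p (volume.restrict (Ioc (0 : ℝ) τ)) :=
    (hp.mono Ioc_subset_Icc_self).aestronglyMeasurable measurableSet_Ioc
  obtain ⟨M, hM⟩ := isCompact_Icc.exists_bound_of_continuousOn hp
  refine ((Control.integrable u).norm.const_mul (‖C.flip‖ * M)).mono' ?_ ?_
  -- The adjoint is isometric, so this map is jointly continuous in `(v, x)`, and measurability
  -- follows by composition.
  · have hc : Continuous fun z : U × X => ContinuousLinearMap.adjoint (C.flip z.1) z.2 := by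
      have h1 : Continuous fun z : U × X => C.flip z.1 := C.flip.continuous.comp continuous_fst
      have h2 : Continuous fun z : U × X => ContinuousLinearMap.adjoint (C.flip z.1) :=
        (ContinuousLinearMap.adjoint (𝕜 := ℝ) (E := K) (F := X)).continuous.comp h1
      exact h2.clm_apply continuous_snd
    have h3 := (Lp.aestronglyMeasurable u).prodMk hpm
    have h4 := hc.comp_aestronglyMeasurable h3
    exact h4
  · filter_upwards [ae_restrict_mem measurableSet_Ioc] with t ht
    calc _ ≤ ‖ContinuousLinearMap.adjoint (C.flip (u t))‖ * ‖p t‖ :=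
          ContinuousLinearMap.le_opNorm _ _
      _ ≤ (‖C.flip‖ * ‖u t‖) * M := by
          rw [LinearIsometryEquiv.norm_map]
          gcongr
          · exact C.flip.le_opNorm _
          · exact hM t (Ioc_subset_Icc_self ht)
      _ = _ := by ring

theorem inner_integral_adjoint_flip {τ : ℝ} (hτ : 0 ≤ τ) (C : K →L[ℝ] (U →L[ℝ] X))
    (u : Control τ U) {p : ℝ → X} (hp : ContinuousOn p (Icc 0 τ)) (h : K) :
    ⟪∫ t in (0 : ℝ)..τ, ContinuousLinearMap.adjoint (C.flip (u t)) (p t), h⟫_ℝ =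
      ∫ t in Ioc 0 τ, ⟪p t, C h (u t)⟫_ℝ := by
  rw [real_inner_comm, intervalIntegral.integral_of_le hτ,
    ← integral_inner (integrable_adjoint_flip C u hp)]
  refine integral_congr_ae (ae_of_all _ fun t => ?_)
  simp only [ContinuousLinearMap.adjoint_inner_right, ContinuousLinearMap.flip_apply]
  exact real_inner_comm _ _

/-- Each term is bounded by `⟪u, b i⟫² + ⟪q, b i⟫²`, and these bounds sum to the integrable function
`‖u‖² + ‖q‖²`. Dominated convergence for series then applies; this is where countability of the
basis is needed. -/
theorem hasSum_integral_inner_mul_inner {ι : Type*} [Countable ι] (b : HilbertBasis ι ℝ U) {τ : ℝ}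
    (u : Control τ U) {q : ℝ → U} (hq : ContinuousOn q (Icc 0 τ)) :
    HasSum (fun i => ∫ t in Ioc 0 τ, ⟪u t, b i⟫_ℝ * ⟪q t, b i⟫_ℝ) (∫ t in Ioc 0 τ, ⟪u t, q t⟫_ℝ) := by
  have hqm : AEStronglyMeasurable q (volume.restrict (Ioc (0 : ℝ) τ)) :=
    (hq.mono Ioc_subset_Icc_self).aestronglyMeasurable measurableSet_Ioc
  have hum := Lp.aestronglyMeasurable u
  obtain ⟨M, hM⟩ := isCompact_Icc.exists_bound_of_continuousOn hq
  have hsq : ∀ x : U, HasSum (fun i => ⟪x, b i⟫_ℝ ^ 2) (‖x‖ ^ 2) := fun x => by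
    simpa only [← sq, real_inner_self_eq_norm_sq] using b.hasSum_inner_mul_inner_real x x
  refine hasSum_integral_of_dominated_convergence
    (bound := fun i t => ⟪u t, b i⟫_ℝ ^ 2 + ⟪q t, b i⟫_ℝ ^ 2) (fun i => ?_) (fun i => ?_) ?_ ?_ ?_
  · exact (hum.inner aestronglyMeasurable_const).mul (hqm.inner aestronglyMeasurable_const)
  · refine ae_of_all _ fun t => ?_
    rw [Real.norm_eq_abs, abs_le]
    constructor <;> nlinarith [sq_nonneg (⟪u t, b i⟫_ℝ + ⟪q t, b i⟫_ℝ),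
      sq_nonneg (⟪u t, b i⟫_ℝ - ⟪q t, b i⟫_ℝ), sq_nonneg ⟪u t, b i⟫_ℝ, sq_nonneg ⟪q t, b i⟫_ℝ]
  · exact ae_of_all _ fun t => ((hsq _).add (hsq _)).summable
  · have : (fun t => ∑' i, (⟪u t, b i⟫_ℝ ^ 2 + ⟪q t, b i⟫_ℝ ^ 2)) =
        fun t => ‖u t‖ ^ 2 + ‖q t‖ ^ 2 := funext fun t => ((hsq _).add (hsq _)).tsum_eq
    rw [this]
    refine (Control.integrable_norm_sq u).add ?_
    refine (integrable_const (M ^ 2)).mono' (hqm.norm.pow 2) ?_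
    filter_upwards [ae_restrict_mem measurableSet_Ioc] with t ht
    rw [Real.norm_eq_abs, abs_of_nonneg (by positivity)]
    gcongr
    exact hM t (Ioc_subset_Icc_self ht)
  · exact ae_of_all _ fun t => b.hasSum_inner_mul_inner_real _ _

/-- The inner series is Parseval in `X` for `b'_i e_j` and the vector `∫ u_i p`. The outer one is
the integrated Parseval identity for `u` and `(B'e_j)*p`. -/
theorem actuatorCondition_iff_components {ιX ιU ιK : Type*} [Countable ιU] {B : K → U →L[ℝ] X}
    {B' : K → K →L[ℝ] (U →L[ℝ] X)} (eX : HilbertBasis ιX ℝ X) (eU : HilbertBasis ιU ℝ U)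
    (eK : HilbertBasis ιK ℝ K) {τ : ℝ} (hτ : 0 ≤ τ) (u : Control τ U) {r : K} {p : ℝ → X}
    (hB : ∀ h, HasLineDerivAt ℝ B (B' r h) r h) (hp : ContinuousOn p (Icc 0 τ)) :
    ActuatorCondition B' u r p ↔ ActuatorConditionComponents B eX eU eK u r p := by
  have hpm : AEStronglyMeasurable p (volume.restrict (Ioc (0 : ℝ) τ)) :=
    (hp.mono Ioc_subset_Icc_self).aestronglyMeasurable measurableSet_Ioc
  have hum := Lp.aestronglyMeasurable u
  obtain ⟨M, hM⟩ := isCompact_Icc.exists_bound_of_continuousOn hp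
  have hint : ∀ i, Integrable (fun t => ⟪u t, eU i⟫_ℝ • p t) (volume.restrict (Ioc (0 : ℝ) τ)) := by
    intro i
    refine ((Control.integrable u).norm.mul_const M).mono'
      ((hum.inner aestronglyMeasurable_const).smul hpm) ?_
    filter_upwards [ae_restrict_mem measurableSet_Ioc] with t ht
    rw [norm_smul]
    gcongr
    · simpa [eU.orthonormal.1 i] using norm_inner_le_norm (𝕜 := ℝ) (u t) (eU i)
    · exact hM t (Ioc_subset_Icc_self ht)
  rw [ActuatorCondition, eK.eq_zero_iff_inner]
  refine forall_congr' fun j => ?_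
  rw [inner_integral_adjoint_flip hτ _ _ hp]
  have h1 : ∀ i, HasSum (fun k => ⟪inputVecDeriv B eU i r (eK j), eX k⟫_ℝ *
      ∫ s in (0 : ℝ)..τ, ⟪u s, eU i⟫_ℝ * ⟪p s, eX k⟫_ℝ)
      (∫ t in Ioc 0 τ, ⟪u t, eU i⟫_ℝ *
        ⟪ContinuousLinearMap.adjoint (B' r (eK j)) (p t), eU i⟫_ℝ) := by
    intro i
    have hd : inputVecDeriv B eU i r (eK j) = B' r (eK j) (eU i) :=
      (hasLineDerivAt_inputVec eU (hB (eK j)) i).lineDeriv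
    have := eX.hasSum_inner_mul_inner_real (inputVecDeriv B eU i r (eK j))
      (∫ t in Ioc 0 τ, ⟪u t, eU i⟫_ℝ • p t)
    rw [← integral_inner (hint i), hd] at this
    simp only [inner_smul_right] at this
    have e : ∀ t, ⟪ContinuousLinearMap.adjoint (B' r (eK j)) (p t), eU i⟫_ℝ =
        ⟪B' r (eK j) (eU i), p t⟫_ℝ := fun t => by
      rw [ContinuousLinearMap.adjoint_inner_left, real_inner_comm]
    simp only [e]
    refine this.congr_fun fun k => ?_
    rw [hd, ← real_inner_comm (∫ t in Ioc 0 τ, ⟪u t, eU i⟫_ℝ • p t), ← integral_inner (hint i),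
      intervalIntegral.integral_of_le hτ]
    simp only [inner_smul_right, real_inner_comm]
  obtain ⟨h2, h3⟩ := DoubleSummable.of_hasSum h1 (hasSum_integral_inner_mul_inner eU u
    ((ContinuousLinearMap.adjoint (B' r (eK j))).continuous.comp_continuousOn hp))
  rw [h3]
  simp only [ContinuousLinearMap.adjoint_inner_right]
  have e : ∀ t, ⟪p t, B' r (eK j) (u t)⟫_ℝ = ⟪B' r (eK j) (u t), p t⟫_ℝ := fun t =>
    real_inner_comm _ _
  simp only [e]
  exact ⟨fun h => ⟨h2, h⟩, fun h => h.2⟩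

/-! ### Convolutions with a bounded, strongly continuous operator family. -/

theorem continuous_uncurry_of_bounded {S : ℝ → X →L[ℝ] X} {M : ℝ} (hM : ∀ t, ‖S t‖ ≤ M)
    (hS : ∀ x, Continuous fun t => S t x) : Continuous fun z : ℝ × X => S z.1 z.2 := by
  rw [continuous_iff_continuousAt]
  rintro ⟨t, x⟩
  have h1 : Tendsto (fun z : ℝ × X => S z.1 x) (𝓝 (t, x)) (𝓝 (S t x)) :=
    (((hS x).comp continuous_fst).tendsto (t, x))
  have h2 : Tendsto (fun z : ℝ × X => S z.1 (z.2 - x)) (𝓝 (t, x)) (𝓝 0) := by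
    have h3 : Tendsto (fun z : ℝ × X => M * ‖z.2 - x‖) (𝓝 (t, x)) (𝓝 0) := by
      have : Continuous fun z : ℝ × X => M * ‖z.2 - x‖ := by fun_prop
      simpa using this.tendsto (t, x)
    refine squeeze_zero_norm (fun z => ?_) h3
    exact ((S z.1).le_opNorm _).trans (mul_le_mul_of_nonneg_right (hM _) (norm_nonneg _))
  have := h1.add h2
  simpa [ContinuousAt] using this

theorem aestronglyMeasurable_kernel {S : ℝ → X →L[ℝ] X} {M : ℝ} (hM : ∀ t, ‖S t‖ ≤ M)
    (hS : ∀ x, Continuous fun t => S t x) {μ : Measure ℝ} {w : ℝ → X}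
    (hw : AEStronglyMeasurable w μ) (t : ℝ) :
    AEStronglyMeasurable (fun s => S (t - s) (w s)) μ := by
  have h1 : AEStronglyMeasurable (fun s => (t - s, w s)) μ :=
    (by fun_prop : Continuous fun s : ℝ => t - s).aestronglyMeasurable.prodMk hw
  have h2 := (continuous_uncurry_of_bounded hM hS).comp_aestronglyMeasurable h1
  exact h2

theorem integrable_kernel {S : ℝ → X →L[ℝ] X} {M : ℝ} (hM : ∀ t, ‖S t‖ ≤ M)
    (hS : ∀ x, Continuous fun t => S t x) {μ : Measure ℝ} {w : ℝ → X}
    (hw : Integrable w μ) (t : ℝ) : Integrable (fun s => S (t - s) (w s)) μ := by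
  refine (hw.norm.const_mul M).mono' (aestronglyMeasurable_kernel hM hS hw.1 t) (ae_of_all _ ?_)
  exact fun s => ((S _).le_opNorm _).trans (mul_le_mul_of_nonneg_right (hM _) (norm_nonneg _))

theorem restrict_Ioc_mono {w : ℝ → X} {τ t : ℝ} (ht : t ∈ Icc 0 τ)
    (hw : Integrable w (volume.restrict (Ioc 0 τ))) : Integrable w (volume.restrict (Ioc 0 t)) :=
  IntegrableOn.mono_set hw (Ioc_subset_Ioc_right ht.2)

theorem norm_convolution_le {S : ℝ → X →L[ℝ] X} {M : ℝ} (hM : ∀ t, ‖S t‖ ≤ M) {w : ℝ → X}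
    {τ t : ℝ} (ht : t ∈ Icc 0 τ) (hw : Integrable w (volume.restrict (Ioc 0 τ))) :
    ‖∫ s in (0 : ℝ)..t, S (t - s) (w s)‖ ≤ M * ∫ s in (0 : ℝ)..t, ‖w s‖ := by
  rw [intervalIntegral.integral_of_le ht.1, intervalIntegral.integral_of_le ht.1,
    ← integral_const_mul]
  refine norm_integral_le_of_norm_le ((restrict_Ioc_mono ht hw).norm.const_mul M)
    (ae_of_all _ fun s => ?_)
  exact ((S _).le_opNorm _).trans (mul_le_mul_of_nonneg_right (hM _) (norm_nonneg _))

theorem convolution_sub {S : ℝ → X →L[ℝ] X} {M : ℝ} (hM : ∀ t, ‖S t‖ ≤ M)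
    (hS : ∀ x, Continuous fun t => S t x) {v w : ℝ → X} {τ t : ℝ} (ht : t ∈ Icc 0 τ)
    (hv : Integrable v (volume.restrict (Ioc 0 τ)))
    (hw : Integrable w (volume.restrict (Ioc 0 τ))) :
    ∫ s in (0 : ℝ)..t, S (t - s) (v s - w s) =
      (∫ s in (0 : ℝ)..t, S (t - s) (v s)) - ∫ s in (0 : ℝ)..t, S (t - s) (w s) := by
  simp only [intervalIntegral.integral_of_le ht.1, map_sub]
  exact integral_sub (integrable_kernel hM hS (restrict_Ioc_mono ht hv) t)
    (integrable_kernel hM hS (restrict_Ioc_mono ht hw) t)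

theorem convolution_add {S : ℝ → X →L[ℝ] X} {M : ℝ} (hM : ∀ t, ‖S t‖ ≤ M)
    (hS : ∀ x, Continuous fun t => S t x) {v w : ℝ → X} {τ t : ℝ} (ht : t ∈ Icc 0 τ)
    (hv : Integrable v (volume.restrict (Ioc 0 τ)))
    (hw : Integrable w (volume.restrict (Ioc 0 τ))) :
    ∫ s in (0 : ℝ)..t, S (t - s) (v s + w s) =
      (∫ s in (0 : ℝ)..t, S (t - s) (v s)) + ∫ s in (0 : ℝ)..t, S (t - s) (w s) := by
  simp only [intervalIntegral.integral_of_le ht.1, map_add]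
  exact integral_add (integrable_kernel hM hS (restrict_Ioc_mono ht hv) t)
    (integrable_kernel hM hS (restrict_Ioc_mono ht hw) t)

theorem continuousOn_convolution {S : ℝ → X →L[ℝ] X} {M : ℝ} (hM : ∀ t, ‖S t‖ ≤ M)
    (hS : ∀ x, Continuous fun t => S t x) {w : ℝ → X} {τ : ℝ}
    (hw : Integrable w (volume.restrict (Ioc 0 τ))) :
    ContinuousOn (fun t => ∫ s in (0 : ℝ)..t, S (t - s) (w s)) (Icc 0 τ) := by
  -- Moving the variable endpoint into an indicator fixes the domain. The integrand is then
  -- continuous in `t` at `t₀` except for `s = t₀`, a null set, so dominated convergence applies.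
  have h1 : Continuous fun t => ∫ s in Ioc 0 τ, (Iic t).indicator (fun s => S (t - s) (w s)) s := by
    rw [continuous_iff_continuousAt]
    intro t₀
    refine continuousAt_of_dominated (bound := fun s => M * ‖w s‖)
      (Eventually.of_forall fun t => ?_) (Eventually.of_forall fun t => ae_of_all _ fun s => ?_)
      (hw.norm.const_mul M) ?_
    · exact (aestronglyMeasurable_kernel hM hS hw.1 t).indicator measurableSet_Iic
    · refine (norm_indicator_le_norm_self _ _).trans ?_
      exact ((S _).le_opNorm _).trans (mul_le_mul_of_nonneg_right (hM _) (norm_nonneg _))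
    · have h0 : ∀ᵐ s ∂(volume.restrict (Ioc 0 τ)), s ≠ t₀ := by
        exact ae_restrict_of_ae (by simp [ae_iff, measure_singleton])
      filter_upwards [h0] with s hs
      rcases lt_or_gt_of_ne hs with h | h
      · have : (fun t => (Iic t).indicator (fun s => S (t - s) (w s)) s) =ᶠ[𝓝 t₀]
            fun t => S (t - s) (w s) := by
          filter_upwards [lt_mem_nhds h] with t ht
          exact indicator_of_mem (mem_Iic.2 (le_of_lt ht)) _
        exact ((hS (w s)).comp (continuous_id.sub continuous_const)).continuousAt.congr this.symm
      · have : (fun t => (Iic t).indicator (fun s => S (t - s) (w s)) s) =ᶠ[𝓝 t₀]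
            fun _ => 0 := by
          filter_upwards [gt_mem_nhds h] with t ht
          exact indicator_of_notMem (by simpa using ht) _
        exact continuousAt_const.congr this.symm
  refine h1.continuousOn.congr fun t ht => ?_
  dsimp only
  rw [integral_indicator measurableSet_Iic, Measure.restrict_restrict measurableSet_Iic,
    intervalIntegral.integral_of_le ht.1]
  congr 2
  ext s
  simp only [mem_Ioc, mem_inter_iff, mem_Iic]
  exact ⟨fun h => ⟨h.2, h.1, h.2.trans ht.2⟩, fun h => ⟨h.2.1, h.1⟩⟩

theorem integral_exp_mul_le {c : ℝ} (hc : 0 < c) (t : ℝ) :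
    ∫ s in (0 : ℝ)..t, Real.exp (c * s) ≤ Real.exp (c * t) / c := by
  have : ∀ s ∈ uIcc 0 t, HasDerivAt (fun s => Real.exp (c * s) / c) (Real.exp (c * s)) s := by
    intro s _
    have := ((hasDerivAt_id s).const_mul c).exp.div_const c
    simpa [hc.ne'] using this
  rw [intervalIntegral.integral_eq_sub_of_hasDerivAt this
    (Continuous.intervalIntegrable (by fun_prop) _ _)]
  simp only [mul_zero, Real.exp_zero]
  have : 0 < 1 / c := by positivity
  linarith

/-- Grönwall with non-optimal constants: at a maximum point of `e^{-ct} φ t` the integral term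
contributes at most `b/c` times the maximum. The choice `c = 2b + 1` makes `b/c ≤ 1/2`, so this term
is absorbed, and keeps `c > 0` when `b = 0`. -/
theorem le_of_le_add_mul_integral {φ : ℝ → ℝ} {τ a b : ℝ} (hφ : ContinuousOn φ (Icc 0 τ))
    (h0 : ∀ t ∈ Icc 0 τ, 0 ≤ φ t) (hb : 0 ≤ b)
    (h : ∀ t ∈ Icc 0 τ, φ t ≤ a + b * ∫ s in (0 : ℝ)..t, φ s) :
    ∀ t ∈ Icc 0 τ, φ t ≤ 2 * a * Real.exp ((2 * b + 1) * τ) := by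
  intro t ht
  set c := 2 * b + 1 with hc
  have hc0 : 0 < c := by positivity
  obtain ⟨t₁, ht₁, hmax⟩ := isCompact_Icc.exists_isMaxOn ⟨t, ht⟩
    (f := fun t => Real.exp (-(c * t)) * φ t) (by fun_prop)
  set m := Real.exp (-(c * t₁)) * φ t₁ with hm
  have hm0 : 0 ≤ m := mul_nonneg (Real.exp_pos _).le (h0 _ ht₁)
  have key : ∀ s ∈ Icc 0 τ, φ s ≤ m * Real.exp (c * s) := by
    intro s hs
    have h1 : Real.exp (-(c * s)) * φ s ≤ m := hmax hs
    have h2 := mul_le_mul_of_nonneg_right h1 (Real.exp_pos (c * s)).le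
    have h3 : Real.exp (-(c * s)) * Real.exp (c * s) = 1 := by rw [← Real.exp_add]; simp
    calc φ s = (Real.exp (-(c * s)) * Real.exp (c * s)) * φ s := by rw [h3, one_mul]
      _ = Real.exp (-(c * s)) * φ s * Real.exp (c * s) := by ring
      _ ≤ _ := h2
  have hint : ∫ s in (0 : ℝ)..t₁, φ s ≤ m * (Real.exp (c * t₁) / c) := by
    calc ∫ s in (0 : ℝ)..t₁, φ s ≤ ∫ s in (0 : ℝ)..t₁, m * Real.exp (c * s) := by
          refine intervalIntegral.integral_mono_on ht₁.1 ?_ ?_ fun s hs =>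
            key s ⟨hs.1, hs.2.trans ht₁.2⟩
          · refine ContinuousOn.intervalIntegrable ?_
            rw [uIcc_of_le ht₁.1]
            exact hφ.mono (Icc_subset_Icc_right ht₁.2)
          · exact Continuous.intervalIntegrable (by fun_prop) _ _
      _ = m * ∫ s in (0 : ℝ)..t₁, Real.exp (c * s) := intervalIntegral.integral_const_mul _ _
      _ ≤ _ := mul_le_mul_of_nonneg_left (integral_exp_mul_le hc0 _) hm0
  have ha : 0 ≤ a := by
    have := h 0 ⟨le_rfl, ht.1.trans ht.2⟩
    have h00 := h0 0 ⟨le_rfl, ht.1.trans ht.2⟩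
    simp at this
    linarith
  have hm2 : m ≤ 2 * a := by
    have h1 : φ t₁ ≤ a + b * (m * (Real.exp (c * t₁) / c)) :=
      (h t₁ ht₁).trans (by gcongr)
    have h2 : m ≤ Real.exp (-(c * t₁)) * (a + b * (m * (Real.exp (c * t₁) / c))) :=
      mul_le_mul_of_nonneg_left h1 (Real.exp_pos _).le
    have h3 : Real.exp (-(c * t₁)) * Real.exp (c * t₁) = 1 := by rw [← Real.exp_add]; simp
    have h4 : Real.exp (-(c * t₁)) * (a + b * (m * (Real.exp (c * t₁) / c))) =
        Real.exp (-(c * t₁)) * a + (Real.exp (-(c * t₁)) * Real.exp (c * t₁)) * (b / c) * m := by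
      ring
    have h5 : Real.exp (-(c * t₁)) ≤ 1 := Real.exp_le_one_iff.2 (by
      have := mul_nonneg hc0.le ht₁.1; linarith)
    have h6 : b / c ≤ 1 / 2 := by rw [div_le_div_iff₀ hc0 (by norm_num)]; linarith
    have h7 := mul_le_mul_of_nonneg_right h5 ha
    have h8 := mul_le_mul_of_nonneg_right h6 hm0
    rw [h4, h3] at h2
    linarith
  calc φ t ≤ m * Real.exp (c * t) := key t ht
    _ ≤ 2 * a * Real.exp (c * τ) := by
        gcongr
        exact ht.2

/-- Banach's fixed point theorem for the rescaled unknown `z t = e^{-ct} y t`. The weight makes the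
Volterra map a contraction on all of `[0, τ]` at once, whatever the size of `M * L`. -/
theorem exists_continuous_solution {S : ℝ → X →L[ℝ] X} {M : ℝ} (hM : ∀ t, ‖S t‖ ≤ M)
    (hS : ∀ x, Continuous fun t => S t x) {τ : ℝ} (hτ : 0 ≤ τ) {G : ℝ → X → X} {L : ℝ}
    (hL : 0 ≤ L) (hGL : ∀ s ∈ Ioc 0 τ, ∀ a b, ‖G s a - G s b‖ ≤ L * ‖a - b‖)
    (hGi : ∀ y : ℝ → X, Continuous y →
      Integrable (fun s => G s (y s)) (volume.restrict (Ioc 0 τ)))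
    {g : ℝ → X} (hg : ContinuousOn g (Icc 0 τ)) :
    ∃ y : ℝ → X, Continuous y ∧
      ∀ t ∈ Icc 0 τ, y t = g t + ∫ s in (0 : ℝ)..t, S (t - s) (G s (y s)) := by
  have hM0 : 0 ≤ M := (norm_nonneg _).trans (hM 0)
  set c := 2 * (M * L) + 1 with hc
  have hc0 : 0 < c := by positivity
  -- Undoes the weight and extends `z` constantly past the endpoints, so the resulting function is
  -- continuous on the whole line.
  let ext : C(Icc (0 : ℝ) τ, X) → ℝ → X := fun z s => Real.exp (c * s) • z (projIcc 0 τ hτ s)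
  have hext : ∀ z, Continuous (ext z) := fun z =>
    (by fun_prop : Continuous fun s => Real.exp (c * s)).smul
      (z.continuous.comp continuous_projIcc)
  let Ψ : C(Icc (0 : ℝ) τ, X) → C(Icc (0 : ℝ) τ, X) := fun z =>
    ⟨fun t => Real.exp (-(c * t)) • (g t + ∫ s in (0 : ℝ)..t, S (t - s) (G s (ext z s))), by
      have h1 := hg.add (continuousOn_convolution hM hS (hGi _ (hext z)))
      exact (by fun_prop : Continuous fun t : Icc (0 : ℝ) τ => Real.exp (-(c * t))).smul
        (continuousOn_iff_continuous_domRestrict.1 h1)⟩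
  have hΨ : ContractingWith (1 / 2) Ψ := by
    refine ⟨by rw [← NNReal.coe_lt_coe]; norm_num, LipschitzWith.of_dist_le_mul fun z₁ z₂ => ?_⟩
    rw [ContinuousMap.dist_le (by positivity)]
    rintro ⟨t, ht⟩
    have hi₁ := hGi _ (hext z₁)
    have hi₂ := hGi _ (hext z₂)
    have e : Ψ z₁ ⟨t, ht⟩ - Ψ z₂ ⟨t, ht⟩ = Real.exp (-(c * t)) •
        ∫ s in (0 : ℝ)..t, S (t - s) (G s (ext z₁ s) - G s (ext z₂ s)) := by
      rw [convolution_sub hM hS ht hi₁ hi₂]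
      simp only [Ψ, ContinuousMap.coe_mk, ← smul_sub, add_sub_add_left_eq_sub]
    have hpt : ∀ s ∈ Ioc 0 t, ‖G s (ext z₁ s) - G s (ext z₂ s)‖ ≤
        L * dist z₁ z₂ * Real.exp (c * s) := by
      intro s hs
      refine (hGL s ⟨hs.1, hs.2.trans ht.2⟩ _ _).trans ?_
      simp only [ext, ← smul_sub, norm_smul, Real.norm_eq_abs, Real.abs_exp]
      have := ContinuousMap.dist_apply_le_dist (f := z₁) (g := z₂) (projIcc 0 τ hτ s)
      rw [dist_eq_norm] at this
      calc L * (Real.exp (c * s) * _) ≤ L * (Real.exp (c * s) * dist z₁ z₂) := by gcongr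
        _ = _ := by ring
    have hint : ∫ s in (0 : ℝ)..t, ‖G s (ext z₁ s) - G s (ext z₂ s)‖ ≤
        L * dist z₁ z₂ * (Real.exp (c * t) / c) := by
      refine le_trans ?_ (mul_le_mul_of_nonneg_left (integral_exp_mul_le hc0 t) (by positivity))
      rw [← intervalIntegral.integral_const_mul, intervalIntegral.integral_of_le ht.1,
        intervalIntegral.integral_of_le ht.1]
      refine setIntegral_mono_on (restrict_Ioc_mono ht (hi₁.sub hi₂)).norm ?_ measurableSet_Ioc hpt
      exact Continuous.integrableOn_Ioc (by fun_prop)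
    rw [dist_eq_norm, e, norm_smul, Real.norm_eq_abs, Real.abs_exp]
    have h3 : Real.exp (-(c * t)) * Real.exp (c * t) = 1 := by rw [← Real.exp_add]; simp
    have h6 : M * L / c ≤ 1 / 2 := by rw [div_le_div_iff₀ hc0 (by norm_num)]; linarith
    calc _ ≤ Real.exp (-(c * t)) * (M * (L * dist z₁ z₂ * (Real.exp (c * t) / c))) := by
          gcongr
          exact (norm_convolution_le hM ht (hi₁.sub hi₂)).trans (by gcongr; exact hint)
      _ = (Real.exp (-(c * t)) * Real.exp (c * t)) * (M * L / c) * dist z₁ z₂ := by ring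
      _ ≤ _ := by
          rw [h3, one_mul]
          refine mul_le_mul_of_nonneg_right (h6.trans (by norm_num)) dist_nonneg
  have : Nonempty C(Icc (0 : ℝ) τ, X) := ⟨0⟩
  set z := hΨ.fixedPoint Ψ
  have hfix : Ψ z = z := hΨ.fixedPoint_isFixedPt
  refine ⟨ext z, hext z, fun t ht => ?_⟩
  have h1 : ext z t = Real.exp (c * t) • Ψ z ⟨t, ht⟩ := by
    simp only [ext]
    rw [hfix, projIcc_of_mem hτ ht]
  rw [h1]
  simp only [Ψ, ContinuousMap.coe_mk, smul_smul, ← Real.exp_add, add_neg_cancel, Real.exp_zero,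
    one_smul]

/-- Fubini on the triangle `s < t`: the adjoint of forward convolution with `S` is backward
convolution with `S*`. -/
theorem integral_inner_convolution {S : ℝ → X →L[ℝ] X} {M : ℝ} (hM : ∀ t, ‖S t‖ ≤ M)
    (hS : ∀ x, Continuous fun t => S t x) [TopologicalSpace.SeparableSpace X] {τ : ℝ}
    {q w : ℝ → X} (hq : Integrable q (volume.restrict (Ioc 0 τ)))
    (hw : Integrable w (volume.restrict (Ioc 0 τ))) :
    ∫ t in Ioc 0 τ, ⟪q t, ∫ s in (0 : ℝ)..t, S (t - s) (w s)⟫_ℝ =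
      ∫ s in Ioc 0 τ, ⟪∫ t in s..τ, ContinuousLinearMap.adjoint (S (t - s)) (q t), w s⟫_ℝ := by
  set μ : Measure ℝ := volume.restrict (Ioc 0 τ) with hμ
  let H : ℝ × ℝ → ℝ := {z | z.2 < z.1}.indicator fun z => ⟪q z.1, S (z.1 - z.2) (w z.2)⟫_ℝ
  have hms : MeasurableSet {z : ℝ × ℝ | z.2 < z.1} := measurableSet_lt measurable_snd measurable_fst
  have hH : Integrable H (μ.prod μ) := by
    refine ((hq.norm.mul_prod hw.norm).const_mul M).mono' ?_ (ae_of_all _ fun z => ?_)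
    · refine AEStronglyMeasurable.indicator ?_ hms
      have h1 : AEStronglyMeasurable (fun z : ℝ × ℝ => (z.1 - z.2, w z.2)) (μ.prod μ) :=
        (by fun_prop : Continuous fun z : ℝ × ℝ => z.1 - z.2).aestronglyMeasurable.prodMk
          hw.1.comp_snd
      have h2 := (continuous_uncurry_of_bounded hM hS).comp_aestronglyMeasurable h1
      exact hq.1.comp_fst.inner h2
    · refine (norm_indicator_le_norm_self _ _).trans ((norm_inner_le_norm _ _).trans ?_)
      calc _ ≤ ‖q z.1‖ * (M * ‖w z.2‖) := by
            gcongr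
            exact ((S _).le_opNorm _).trans (mul_le_mul_of_nonneg_right (hM _) (norm_nonneg _))
        _ = _ := by ring
  have hswap := integral_integral_swap (f := fun t s => H (t, s)) hH
  have hl : ∀ t ∈ Ioc 0 τ, ∫ s, H (t, s) ∂μ = ⟪q t, ∫ s in (0 : ℝ)..t, S (t - s) (w s)⟫_ℝ := by
    intro t ht
    have ht' : t ∈ Icc 0 τ := Ioc_subset_Icc_self ht
    have e : (fun s => H (t, s)) = (Iio t).indicator fun s => ⟪q t, S (t - s) (w s)⟫_ℝ := by
      ext s; simp [H, indicator]
    rw [e, integral_indicator measurableSet_Iio, hμ, Measure.restrict_restrict measurableSet_Iio,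
      intervalIntegral.integral_of_le ht.1.le,
      ← integral_inner (integrable_kernel hM hS (restrict_Ioc_mono ht' hw) t),
      integral_Ioc_eq_integral_Ioo]
    congr 2
    ext s
    simp only [mem_Ioo, mem_Ioc, mem_inter_iff, mem_Iio]
    exact ⟨fun h => ⟨h.2.1, h.1⟩, fun h => ⟨h.2, h.1, h.2.le.trans ht.2⟩⟩
  have hr : ∀ s ∈ Ioc 0 τ, ∫ t, H (t, s) ∂μ =
      ⟪∫ t in s..τ, ContinuousLinearMap.adjoint (S (t - s)) (q t), w s⟫_ℝ := by
    intro s hs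
    have hqs : Integrable q (volume.restrict (Ioc s τ)) :=
      IntegrableOn.mono_set hq (Ioc_subset_Ioc_left hs.1.le)
    have hint : Integrable (fun t => ContinuousLinearMap.adjoint (S (t - s)) (q t))
        (volume.restrict (Ioc s τ)) := by
      refine (hqs.norm.const_mul M).mono' (aestronglyMeasurable_of_inner fun v => ?_)
        (ae_of_all _ fun t => ?_)
      · simp only [ContinuousLinearMap.adjoint_inner_right]
        exact ((hS v).comp (continuous_id.sub continuous_const)).aestronglyMeasurable.inner hqs.1
      · refine (ContinuousLinearMap.le_opNorm _ _).trans ?_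
        rw [LinearIsometryEquiv.norm_map]
        exact mul_le_mul_of_nonneg_right (hM _) (norm_nonneg _)
    have e : (fun t => H (t, s)) = (Ioi s).indicator fun t => ⟪q t, S (t - s) (w s)⟫_ℝ := by
      ext t; simp [H, indicator]
    rw [e, integral_indicator measurableSet_Ioi, hμ, Measure.restrict_restrict measurableSet_Ioi,
      intervalIntegral.integral_of_le hs.2, real_inner_comm, ← integral_inner hint]
    have e2 : Ioi s ∩ Ioc 0 τ = Ioc s τ := by
      ext t
      simp only [mem_Ioc, mem_inter_iff, mem_Ioi]
      exact ⟨fun h => ⟨h.1, h.2.2⟩, fun h => ⟨h.1, hs.1.trans h.1, h.2⟩⟩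
    rw [e2]
    simp only [ContinuousLinearMap.adjoint_inner_right, real_inner_comm]
  rw [← setIntegral_congr_fun measurableSet_Ioc hl, ← setIntegral_congr_fun measurableSet_Ioc hr]
  exact hswap

/-! ### Truncation, and Gâteaux differentiable nonlinearities. -/

/-- `P` is the metric projection onto the ball; its variational characterisation makes it
nonexpansive. Composition with `P` turns a map that is Lipschitz on this ball into a globally
Lipschitz one. -/
theorem exists_retraction_closedBall (X : Type*) [NormedAddCommGroup X] [InnerProductSpace ℝ X]
    [CompleteSpace X] {r : ℝ} (hr : 0 ≤ r) :
    ∃ P : X → X, (∀ x, ‖P x‖ ≤ r) ∧ (∀ x, ‖x‖ ≤ r → P x = x) ∧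
      ∀ x y, ‖P x - P y‖ ≤ ‖x - y‖ := by
  have hconv : Convex ℝ (Metric.closedBall (0 : X) r) := convex_closedBall 0 r
  choose P hP hPi using exists_norm_eq_iInf_of_complete_convex
    (K := Metric.closedBall (0 : X) r) ⟨0, by simpa using hr⟩ Metric.isClosed_closedBall.isComplete
    hconv
  have hPr : ∀ x, ∀ w ∈ Metric.closedBall (0 : X) r, ⟪x - P x, w - P x⟫_ℝ ≤ 0 := fun x =>
    (norm_eq_iInf_iff_real_inner_le_zero hconv (hP x)).1 (hPi x)
  refine ⟨P, fun x => by simpa using hP x, fun x hx => ?_, fun x y => ?_⟩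
  · have := hPr x x (by simpa using hx)
    rw [real_inner_self_eq_norm_sq] at this
    have h0 : ‖x - P x‖ = 0 := by nlinarith [norm_nonneg (x - P x)]
    exact (sub_eq_zero.1 (norm_eq_zero.1 h0)).symm
  · have h1 := hPr x (P y) (hP y)
    have h2 := hPr y (P x) (hP x)
    have h3 : ‖P x - P y‖ ^ 2 = ⟪x - y, P x - P y⟫_ℝ + ⟪x - P x, P y - P x⟫_ℝ +
        ⟪y - P y, P x - P y⟫_ℝ := by
      rw [← real_inner_self_eq_norm_sq]
      simp only [inner_sub_left, inner_sub_right]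
      ring
    have h4 := real_inner_le_norm (x - y) (P x - P y)
    by_contra! h
    nlinarith [norm_nonneg (P x - P y), norm_nonneg (x - y)]

variable {F : X → X} {F' : X → X →L[ℝ] X}

theorem IsGateauxDerivOn.hasLineDerivAt (hF : IsGateauxDerivOn F F' univ) (x h : X) :
    HasLineDerivAt ℝ F (F' x h) x h :=
  hasLineDerivWithinAt_univ.1 (hF x (mem_univ x) h)

theorem MapsBoundedToBounded.exists_bound (hF' : MapsBoundedToBounded F' univ) (r : ℝ) :
    ∃ L, 0 ≤ L ∧ ∀ x, ‖x‖ ≤ r → ‖F' x‖ ≤ L := by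
  obtain ⟨L, hL⟩ := (hF' (Metric.closedBall 0 r) (subset_univ _)
    Metric.isBounded_closedBall).exists_norm_le
  refine ⟨max L 0, le_max_right _ _, fun x hx => (hL _ ?_).trans (le_max_left _ _)⟩
  exact mem_image_of_mem _ (by simpa using hx)

/-- The mean value inequality on the segment from `x` to `y`, which stays in the ball by convexity,
needs derivatives along that line only. -/
theorem IsGateauxDerivOn.norm_sub_le (hF : IsGateauxDerivOn F F' univ) {r L : ℝ}
    (hL : ∀ x, ‖x‖ ≤ r → ‖F' x‖ ≤ L) {x y : X} (hx : ‖x‖ ≤ r) (hy : ‖y‖ ≤ r) :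
    ‖F y - F x‖ ≤ L * ‖y - x‖ := by
  have hd : ∀ θ : ℝ, HasDerivAt (fun θ : ℝ => F (x + θ • (y - x)))
      (F' (x + θ • (y - x)) (y - x)) θ := by
    intro θ
    have h1 : HasDerivAt (fun t : ℝ => F ((x + θ • (y - x)) + t • (y - x)))
        (F' (x + θ • (y - x)) (y - x)) (θ - θ) := by
      rw [sub_self]; exact hF.hasLineDerivAt _ _
    have h2 := h1.comp_sub_const θ θ
    refine h2.congr_of_eventuallyEq (Eventually.of_forall fun t => ?_)
    simp only [add_assoc, ← add_smul, add_sub_cancel]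
  have hmem : ∀ θ ∈ Ico (0 : ℝ) 1, ‖x + θ • (y - x)‖ ≤ r := by
    intro θ hθ
    have := (convex_closedBall (0 : X) r).add_smul_sub_mem (x := x) (y := y) (by simpa using hx)
      (by simpa using hy) ⟨hθ.1, hθ.2.le⟩
    simpa using this
  have := norm_image_sub_le_of_norm_deriv_le_segment_01' (C := L * ‖y - x‖)
    (fun θ _ => (hd θ).hasDerivWithinAt) fun θ hθ =>
      ((F' _).le_opNorm _).trans (mul_le_mul_of_nonneg_right (hL _ (hmem θ hθ)) (norm_nonneg _))
  simpa using this

theorem IsGateauxDerivOn.continuous (hF : IsGateauxDerivOn F F' univ)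
    (hF' : MapsBoundedToBounded F' univ) : Continuous F := by
  rw [continuous_iff_continuousAt]
  intro x
  obtain ⟨L, hL0, hL⟩ := hF'.exists_bound (‖x‖ + 1)
  rw [ContinuousAt, tendsto_iff_norm_sub_tendsto_zero]
  have h1 : Tendsto (fun y => L * ‖y - x‖) (𝓝 x) (𝓝 0) := by
    have : Continuous fun y => L * ‖y - x‖ := by fun_prop
    simpa using this.tendsto x
  refine squeeze_zero' (Eventually.of_forall fun _ => norm_nonneg _) ?_ h1
  filter_upwards [Metric.ball_mem_nhds x one_pos] with y hy
  refine hF.norm_sub_le hL (by linarith) ?_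
  have : ‖y - x‖ < 1 := by simpa [dist_eq_norm] using hy
  calc ‖y‖ = ‖x + (y - x)‖ := by simp
    _ ≤ ‖x‖ + 1 := (norm_add_le _ _).trans (by linarith)

theorem _root_.HasLineDerivAt.tendsto_inv_smul {E G : Type*} [NormedAddCommGroup E]
    [NormedSpace ℝ E] [NormedAddCommGroup G] [NormedSpace ℝ G] {f : E → G} {f' : G} {x h : E}
    (hf : HasLineDerivAt ℝ f f' x h) :
    Tendsto (fun ε : ℝ => ε⁻¹ • (f (x + ε • h) - f x)) (𝓝[>] 0) (𝓝 f') := by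
  have h1 := (hasDerivAt_iff_tendsto_slope_zero.1 hf).mono_left
    (nhdsWithin_mono (0 : ℝ) (s := Ioi 0) fun a (ha : 0 < a) => ha.ne')
  simpa using h1

/-- No continuity of `x ↦ F' x` is assumed; measurability is inherited from the difference quotients
of the continuous map `F`. -/
theorem IsGateauxDerivOn.aestronglyMeasurable_deriv (hF : IsGateauxDerivOn F F' univ)
    (hF' : MapsBoundedToBounded F' univ) {μ : Measure ℝ} {x y : ℝ → X} (hx : Continuous x)
    (hy : Continuous y) : AEStronglyMeasurable (fun t => F' (x t) (y t)) μ := by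
  have hc := hF.continuous hF'
  refine aestronglyMeasurable_of_tendsto_ae (𝓝[>] (0 : ℝ))
    (f := fun ε t => ε⁻¹ • (F (x t + ε • y t) - F (x t))) (fun ε => ?_)
    (ae_of_all _ fun t => (hF.hasLineDerivAt (x t) (y t)).tendsto_inv_smul)
  exact (by fun_prop : Continuous fun t =>
    ε⁻¹ • (F (x t + ε • y t) - F (x t))).aestronglyMeasurable

theorem exists_norm_le_of_continuous {x : ℝ → X} (hx : Continuous x) (τ : ℝ) :
    ∃ C, 0 ≤ C ∧ ∀ t ∈ Icc 0 τ, ‖x t‖ ≤ C := by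
  obtain ⟨C, hC⟩ := isCompact_Icc.exists_bound_of_continuousOn (s := Icc 0 τ) hx.continuousOn
  exact ⟨max C 0, le_max_right _ _, fun t ht => (hC t ht).trans (le_max_left _ _)⟩

theorem IsGateauxDerivOn.integrable_deriv (hF : IsGateauxDerivOn F F' univ)
    (hF' : MapsBoundedToBounded F' univ) {x y : ℝ → X} (hx : Continuous x)
    (hy : Continuous y) (τ : ℝ) :
    Integrable (fun t => F' (x t) (y t)) (volume.restrict (Ioc 0 τ)) := by
  obtain ⟨C, -, hC⟩ := exists_norm_le_of_continuous hx τ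
  obtain ⟨D, hD0, hD⟩ := exists_norm_le_of_continuous hy τ
  obtain ⟨L, hL0, hL⟩ := hF'.exists_bound C
  refine (integrable_const (L * D)).mono' (hF.aestronglyMeasurable_deriv hF' hx hy) ?_
  filter_upwards [ae_restrict_mem measurableSet_Ioc] with t ht
  have ht' := Ioc_subset_Icc_self ht
  exact ((F' _).le_opNorm _).trans (mul_le_mul (hL _ (hC t ht')) (hD t ht') (norm_nonneg _) hL0)

/-- The sensitivity of the state: along a curve of forcing terms `f ε` with derivative `g` at
`ε = 0` in the sense of `L¹`, the solutions of the semilinear equation exist for small `ε` and are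
differentiable at `ε = 0`, uniformly in time, with derivative the solution `y` of the linearised
equation. -/
theorem exists_perturbed_solution {S : ℝ → X →L[ℝ] X} {M : ℝ} (hM : ∀ t, ‖S t‖ ≤ M)
    (hS : ∀ x, Continuous fun t => S t x) {τ : ℝ} (hτ : 0 ≤ τ)
    (hF : IsGateauxDerivOn F F' univ) (hF' : MapsBoundedToBounded F' univ)
    {a x₀ f₀ g : ℝ → X} {f : ℝ → ℝ → X} (ha : ContinuousOn a (Icc 0 τ)) (hx₀ : Continuous x₀)
    (hf₀ : Integrable f₀ (volume.restrict (Ioc 0 τ)))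
    (hg : Integrable g (volume.restrict (Ioc 0 τ)))
    (hf : ∀ ε, Integrable (f ε) (volume.restrict (Ioc 0 τ)))
    (hx₀e : ∀ t ∈ Icc 0 τ, x₀ t = a t + (∫ s in (0 : ℝ)..t, S (t - s) (F (x₀ s))) +
      ∫ s in (0 : ℝ)..t, S (t - s) (f₀ s))
    (hfg : Tendsto (fun ε : ℝ => ε⁻¹ * ∫ s in Ioc 0 τ, ‖f ε s - f₀ s - ε • g s‖) (𝓝[>] 0) (𝓝 0)) :
    ∃ (y : ℝ → X) (x : ℝ → ℝ → X) (δ : ℝ → ℝ), Continuous y ∧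
      (∀ t ∈ Icc 0 τ, y t = ∫ s in (0 : ℝ)..t, S (t - s) (F' (x₀ s) (y s) + g s)) ∧
      (∀ ε, Continuous (x ε)) ∧ Tendsto δ (𝓝[>] 0) (𝓝 0) ∧
      ∀ᶠ ε in 𝓝[>] 0, (∀ t ∈ Icc 0 τ, ‖x ε t - x₀ t - ε • y t‖ ≤ ε * δ ε) ∧
        ∀ t ∈ Icc 0 τ, x ε t = a t + (∫ s in (0 : ℝ)..t, S (t - s) (F (x ε s))) +
          ∫ s in (0 : ℝ)..t, S (t - s) (f ε s) := by
  have hM0 : 0 ≤ M := (norm_nonneg _).trans (hM 0)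
  obtain ⟨C, hC0, hC⟩ := exists_norm_le_of_continuous hx₀ τ
  -- The radius exceeds the bound `C` of `x₀` by `1`, which leaves room for small perturbations of
  -- `x₀` to be untouched by `P`.
  obtain ⟨P, hPr, hPe, hPl⟩ := exists_retraction_closedBall X (r := C + 1) (by positivity)
  obtain ⟨L, hL0, hL⟩ := hF'.exists_bound (C + 1)
  have hPc : Continuous P := (LipschitzWith.of_dist_le_mul (K := 1) fun x y => by
    simpa [dist_eq_norm] using hPl x y).continuous
  have hFc := hF.continuous hF'
  have hFl : ∀ x y, ‖F (P x) - F (P y)‖ ≤ L * ‖x - y‖ := fun x y =>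
    (hF.norm_sub_le hL (hPr y) (hPr x)).trans (by gcongr; exact hPl x y)
  have hFi : ∀ y : ℝ → X, Continuous y →
      Integrable (fun s => F (P (y s))) (volume.restrict (Ioc 0 τ)) := fun y hy =>
    (hFc.comp (hPc.comp hy)).integrableOn_Ioc
  have hFx₀ : ∀ s ∈ Icc 0 τ, F (P (x₀ s)) = F (x₀ s) := fun s hs => by
    rw [hPe _ ((hC s hs).trans (by linarith))]
  have hF'L : ∀ s ∈ Icc 0 τ, ‖F' (x₀ s)‖ ≤ L := fun s hs => hL _ ((hC s hs).trans (by linarith))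
  -- the truncated states
  have hex : ∀ ε, ∃ x : ℝ → X, Continuous x ∧ ∀ t ∈ Icc 0 τ,
      x t = (a t + ∫ s in (0 : ℝ)..t, S (t - s) (f ε s)) +
        ∫ s in (0 : ℝ)..t, S (t - s) (F (P (x s))) := fun ε =>
    exists_continuous_solution hM hS hτ (G := fun _ x => F (P x)) hL0 (fun _ _ => hFl) hFi
      (ha.add (continuousOn_convolution hM hS (hf ε)))
  choose x hxc hxe using hex
  obtain ⟨y, hyc, hye⟩ := exists_continuous_solution hM hS hτ
    (G := fun s v => F' (x₀ s) v + g s) hL0 (fun s hs v w => by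
      rw [add_sub_add_right_eq_sub, ← map_sub]
      exact ((F' _).le_opNorm _).trans
        (mul_le_mul_of_nonneg_right (hF'L s (Ioc_subset_Icc_self hs)) (norm_nonneg _)))
    (fun y hy => (hF.integrable_deriv hF' hx₀ hy τ).add hg) (g := fun _ => 0) continuousOn_const
  simp only [zero_add] at hye
  obtain ⟨Y, hY0, hY⟩ := exists_norm_le_of_continuous hyc τ
  have hF'i := hF.integrable_deriv hF' hx₀ hyc τ
  -- `ρ` is the linearisation error of the truncated nonlinearity along `x₀ + ε • y`, and `η` that
  -- of the forcing. Only their integrals, divided by `ε`, enter `δ`; the factor `N` is the Grönwall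
  -- constant.
  let ρ : ℝ → ℝ → ℝ := fun ε s => ‖F (P (x₀ s + ε • y s)) - F (P (x₀ s)) - ε • F' (x₀ s) (y s)‖
  let η : ℝ → ℝ → ℝ := fun ε s => ‖f ε s - f₀ s - ε • g s‖
  have hρi : ∀ ε, Integrable (ρ ε) (volume.restrict (Ioc 0 τ)) := fun ε =>
    (((hFi _ (by fun_prop)).sub (hFi _ hx₀)).sub (hF'i.smul ε)).norm
  have hηi : ∀ ε, Integrable (η ε) (volume.restrict (Ioc 0 τ)) := fun ε =>
    (((hf ε).sub hf₀).sub (hg.smul ε)).norm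
  let N := 2 * M * Real.exp ((2 * (M * L) + 1) * τ)
  let δ : ℝ → ℝ := fun ε => N * (ε⁻¹ * (∫ s in Ioc 0 τ, ρ ε s) + ε⁻¹ * ∫ s in Ioc 0 τ, η ε s)
  have hest : ∀ ε : ℝ, 0 < ε → ∀ t ∈ Icc 0 τ, ‖x ε t - x₀ t - ε • y t‖ ≤ ε * δ ε := by
    intro ε hε t ht
    let z : ℝ → X := fun t => x ε t - x₀ t - ε • y t
    have hzc : Continuous z := ((hxc ε).sub hx₀).sub (hyc.const_smul ε)
    let W : ℝ → X := fun s => (F (P (x ε s)) - F (P (x₀ s)) - ε • F' (x₀ s) (y s)) +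
      (f ε s - f₀ s - ε • g s)
    have i₁ : Integrable (fun s => F (P (x ε s)) - F (P (x₀ s))) (volume.restrict (Ioc 0 τ)) :=
      (hFi _ (hxc ε)).sub (hFi _ hx₀)
    have i₂ : Integrable (fun s => ε • F' (x₀ s) (y s)) (volume.restrict (Ioc 0 τ)) := hF'i.smul ε
    have i₃ : Integrable (fun s => F (P (x ε s)) - F (P (x₀ s)) - ε • F' (x₀ s) (y s))
      (volume.restrict (Ioc 0 τ)) := i₁.sub i₂
    have i₄ : Integrable (fun s => f ε s - f₀ s) (volume.restrict (Ioc 0 τ)) := (hf ε).sub hf₀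
    have i₅ : Integrable (fun s => ε • g s) (volume.restrict (Ioc 0 τ)) := hg.smul ε
    have i₆ : Integrable (fun s => f ε s - f₀ s - ε • g s) (volume.restrict (Ioc 0 τ)) :=
      i₄.sub i₅
    have hWi : Integrable W (volume.restrict (Ioc 0 τ)) := i₃.add i₆
    have i₇ : Integrable (fun s => ρ ε s + η ε s) (volume.restrict (Ioc 0 τ)) :=
      (hρi ε).add (hηi ε)
    have hz : ∀ t ∈ Icc 0 τ, z t = ∫ s in (0 : ℝ)..t, S (t - s) (W s) := by
      intro t ht
      have e1 : x₀ t = a t + (∫ s in (0 : ℝ)..t, S (t - s) (F (P (x₀ s)))) +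
          ∫ s in (0 : ℝ)..t, S (t - s) (f₀ s) := by
        rw [hx₀e t ht]
        congr 2
        refine intervalIntegral.integral_congr fun s hs => ?_
        rw [uIcc_of_le ht.1] at hs
        simp only [hFx₀ s ⟨hs.1, hs.2.trans ht.2⟩]
      have e2 : ε • y t = (∫ s in (0 : ℝ)..t, S (t - s) (ε • F' (x₀ s) (y s))) +
          ∫ s in (0 : ℝ)..t, S (t - s) (ε • g s) := by
        rw [hye t ht, convolution_add hM hS ht hF'i hg, smul_add,
          ← intervalIntegral.integral_smul, ← intervalIntegral.integral_smul]
        simp only [map_smul]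
      simp only [z, W]
      rw [convolution_add hM hS ht i₃ i₆, convolution_sub hM hS ht i₁ i₂,
        convolution_sub hM hS ht (hFi _ (hxc ε)) (hFi _ hx₀), convolution_sub hM hS ht i₄ i₅,
        convolution_sub hM hS ht (hf ε) hf₀, e2, e1, hxe ε t ht]
      abel
    -- Inserting `F (P (x₀ s + ε • y s))` splits off a Lipschitz term in `z` from the two
    -- linearisation errors.
    have hW : ∀ s, ‖W s‖ ≤ L * ‖z s‖ + (ρ ε s + η ε s) := by
      intro s
      have e : W s = (F (P (x ε s)) - F (P (x₀ s + ε • y s))) +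
          ((F (P (x₀ s + ε • y s)) - F (P (x₀ s)) - ε • F' (x₀ s) (y s)) +
            (f ε s - f₀ s - ε • g s)) := by simp only [W]; abel
      rw [e]
      refine (norm_add_le _ _).trans (add_le_add ?_ (norm_add_le _ _))
      refine (hFl _ _).trans (le_of_eq ?_)
      simp only [z, sub_sub]
    have hgr := le_of_le_add_mul_integral (φ := fun t => ‖z t‖) (τ := τ)
      (a := M * ((∫ s in Ioc 0 τ, ρ ε s) + ∫ s in Ioc 0 τ, η ε s)) (b := M * L)
      hzc.norm.continuousOn (fun _ _ => norm_nonneg _) (by positivity) (fun t ht => by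
        have h1 : ∫ s in Ioc 0 t, ‖W s‖ ≤ L * (∫ s in Ioc 0 t, ‖z s‖) +
            ((∫ s in Ioc 0 τ, ρ ε s) + ∫ s in Ioc 0 τ, η ε s) := by
          calc ∫ s in Ioc 0 t, ‖W s‖ ≤ ∫ s in Ioc 0 t, (L * ‖z s‖ + (ρ ε s + η ε s)) := by
                refine integral_mono (restrict_Ioc_mono ht hWi).norm ?_ hW
                exact (hzc.norm.integrableOn_Ioc.const_mul L).add
                  (IntegrableOn.mono_set i₇ (Ioc_subset_Ioc_right ht.2))
            _ = L * (∫ s in Ioc 0 t, ‖z s‖) + ∫ s in Ioc 0 t, (ρ ε s + η ε s) := by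
                rw [integral_add (hzc.norm.integrableOn_Ioc.const_mul L)
                  (IntegrableOn.mono_set i₇ (Ioc_subset_Ioc_right ht.2)),
                  integral_const_mul]
            _ ≤ _ := by
                rw [← integral_add (hρi ε) (hηi ε)]
                refine add_le_add le_rfl ?_
                refine setIntegral_mono_set i₇ (ae_of_all _ fun s => ?_)
                  (Ioc_subset_Ioc_right ht.2).eventuallyLE
                exact add_nonneg (norm_nonneg _) (norm_nonneg _)
        rw [hz t ht]
        refine (norm_convolution_le hM ht hWi).trans ?_
        rw [intervalIntegral.integral_of_le ht.1, intervalIntegral.integral_of_le ht.1]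
        refine (mul_le_mul_of_nonneg_left h1 hM0).trans (le_of_eq ?_)
        ring) t ht
    refine hgr.trans (le_of_eq ?_)
    simp only [δ, N]
    field_simp
  have hδ : Tendsto δ (𝓝[>] 0) (𝓝 0) := by
    have h1 : Tendsto (fun ε : ℝ => ε⁻¹ * ∫ s in Ioc 0 τ, ρ ε s) (𝓝[>] 0) (𝓝 0) := by
      have h2 : Tendsto (fun ε : ℝ => ∫ s in Ioc 0 τ, ε⁻¹ * ρ ε s) (𝓝[>] 0)
          (𝓝 (∫ _ in Ioc 0 τ, (0 : ℝ))) := by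
        -- Gâteaux differentiability gives only pointwise convergence in `s`. The Lipschitz bound on
        -- `F ∘ P` and the bound on `F'` each contribute `L * Y` to the dominating constant.
        refine tendsto_integral_filter_of_dominated_convergence (fun _ => 2 * (L * Y))
          (Eventually.of_forall fun ε => (hρi ε).1.const_mul _) ?_ (integrable_const _) ?_
        · filter_upwards [self_mem_nhdsWithin] with ε (hε : 0 < ε)
          filter_upwards [ae_restrict_mem measurableSet_Ioc] with s hs
          have hs' := Ioc_subset_Icc_self hs
          have h3 : ρ ε s ≤ L * (ε * Y) + ε * (L * Y) := by
            refine (norm_sub_le _ _).trans (add_le_add ((hFl _ _).trans ?_) ?_)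
            · rw [add_sub_cancel_left, norm_smul, Real.norm_of_nonneg hε.le]
              gcongr
              exact hY s hs'
            · rw [norm_smul, Real.norm_of_nonneg hε.le]
              gcongr
              exact ((F' _).le_opNorm _).trans
                (mul_le_mul (hF'L s hs') (hY s hs') (norm_nonneg _) hL0)
          rw [Real.norm_of_nonneg (mul_nonneg (inv_nonneg.2 hε.le) (norm_nonneg _))]
          calc ε⁻¹ * ρ ε s ≤ ε⁻¹ * (L * (ε * Y) + ε * (L * Y)) := by gcongr
            _ = _ := by field_simp; ring
        · filter_upwards [ae_restrict_mem measurableSet_Ioc] with s hs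
          have hs' := Ioc_subset_Icc_self hs
          have h4 := (hF.hasLineDerivAt (x₀ s) (y s)).tendsto_inv_smul
          have h5 := (h4.sub_const (F' (x₀ s) (y s))).norm
          rw [sub_self, norm_zero] at h5
          have h6 : ∀ᶠ ε : ℝ in 𝓝[>] 0, ε * Y < 1 := by
            have : Tendsto (fun ε : ℝ => ε * Y) (𝓝[>] 0) (𝓝 0) := by
              have : Continuous fun ε : ℝ => ε * Y := by fun_prop
              exact (by simpa using this.tendsto 0 : Tendsto _ _ _).mono_left nhdsWithin_le_nhds
            exact this.eventually (gt_mem_nhds one_pos)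
          refine h5.congr' ?_
          filter_upwards [h6, self_mem_nhdsWithin] with ε hε1 (hε : 0 < ε)
          have h7 : ‖x₀ s + ε • y s‖ ≤ C + 1 := by
            refine (norm_add_le _ _).trans (add_le_add (hC s hs') ?_)
            rw [norm_smul, Real.norm_of_nonneg hε.le]
            exact (mul_le_mul_of_nonneg_left (hY s hs') hε.le).trans hε1.le
          simp only [ρ]
          rw [hPe _ h7, hFx₀ s hs']
          conv_rhs => rw [← Real.norm_of_nonneg (inv_nonneg.2 hε.le), ← norm_smul, smul_sub,
            smul_smul, inv_mul_cancel₀ hε.ne', one_smul]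
      simpa [integral_const_mul] using h2
    simpa [δ] using (h1.add hfg).const_mul N
  refine ⟨y, x, δ, hyc, hye, hxc, hδ, ?_⟩
  -- For such `ε` the truncated state stays in the ball of radius `C + 1`, where `P` is the
  -- identity, so it solves the original equation.
  have hsmall : ∀ᶠ ε : ℝ in 𝓝[>] 0, ε * δ ε + ε * Y < 1 := by
    have h0 : Tendsto (fun ε : ℝ => ε) (𝓝[>] 0) (𝓝 0) := tendsto_id.mono_left nhdsWithin_le_nhds
    have : Tendsto (fun ε : ℝ => ε * δ ε + ε * Y) (𝓝[>] 0) (𝓝 0) := by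
      simpa using (h0.mul hδ).add (h0.mul_const Y)
    exact this.eventually (gt_mem_nhds one_pos)
  filter_upwards [hsmall, self_mem_nhdsWithin] with ε hε1 (hε : 0 < ε)
  refine ⟨hest ε hε, fun t ht => ?_⟩
  have hball : ∀ s ∈ Icc 0 τ, P (x ε s) = x ε s := by
    intro s hs
    refine hPe _ ?_
    have e : x ε s = (x ε s - x₀ s - ε • y s) + ε • y s + x₀ s := by abel
    have h1 : ‖ε • y s‖ ≤ ε * Y := by
      rw [norm_smul, Real.norm_of_nonneg hε.le]
      exact mul_le_mul_of_nonneg_left (hY s hs) hε.le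
    have h2 := hest ε hε s hs
    have h3 := hC s hs
    rw [e]
    refine (norm_add₃_le).trans ?_
    linarith
  rw [hxe ε t ht, add_right_comm]
  congr 2
  refine intervalIntegral.integral_congr fun s hs => ?_
  rw [uIcc_of_le ht.1] at hs
  simp only [hball s ⟨hs.1, hs.2.trans ht.2⟩]

/-! ### The semigroup on the time interval, the cost, and the adjoint identity. -/

theorem C0Semigroup.exists_bound (T : C0Semigroup X) (τ : ℝ) :
    ∃ M, ∀ t ∈ Icc 0 τ, ‖T.toFun t‖ ≤ M := by
  obtain ⟨M, hM⟩ := banach_steinhaus (g := fun t : Icc (0 : ℝ) τ => T.toFun t) fun x => by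
    obtain ⟨C, hC⟩ := isCompact_Icc.exists_bound_of_continuousOn
      ((T.strongly_continuous x).mono (Icc_subset_Ici_self : Icc 0 τ ⊆ Ici 0))
    exact ⟨C, fun t => hC t t.2⟩
  exact ⟨M, fun t ht => hM ⟨t, ht⟩⟩

/-- Clamping time to `[0, τ]` gives a family that is bounded and strongly continuous on all of `ℝ`.
The semigroup law is lost, but the arguments on mild solutions do not need it. -/
theorem C0Semigroup.exists_extension (T : C0Semigroup X) {τ : ℝ} (hτ : 0 ≤ τ) :
    ∃ (S : ℝ → X →L[ℝ] X) (M : ℝ), (∀ t, ‖S t‖ ≤ M) ∧ (∀ x, Continuous fun t => S t x) ∧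
      ∀ t ∈ Icc 0 τ, S t = T.toFun t := by
  obtain ⟨M, hM⟩ := T.exists_bound τ
  refine ⟨fun t => T.toFun (projIcc 0 τ hτ t), M, fun t => hM _ (projIcc 0 τ hτ t).2,
    fun x => ?_, fun t ht => by simp only [projIcc_of_mem hτ ht]⟩
  exact ((T.strongly_continuous x).mono (Icc_subset_Ici_self : Icc 0 τ ⊆ Ici 0)).comp_continuous
    (continuous_subtype_val.comp continuous_projIcc) fun t => (projIcc 0 τ hτ t).2

theorem isMildSolution_iff {T : C0Semigroup X} {S : ℝ → X →L[ℝ] X} {τ : ℝ}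
    (hST : ∀ t ∈ Icc 0 τ, S t = T.toFun t) {F : X → X} {G : U →L[ℝ] X} {u : Control τ U} {ξ : X}
    {x : ℝ → X} : IsMildSolution T F G u ξ x ↔ ContinuousOn x (Icc 0 τ) ∧
      ∀ t ∈ Icc 0 τ, x t = S t ξ + (∫ s in (0 : ℝ)..t, S (t - s) (F (x s))) +
        ∫ s in (0 : ℝ)..t, S (t - s) (G (u s)) := by
  refine and_congr_right fun _ => forall₂_congr fun t ht => ?_
  have e : ∀ w : ℝ → X, ∫ s in (0 : ℝ)..t, S (t - s) (w s) =
      ∫ s in (0 : ℝ)..t, T.toFun (t - s) (w s) := fun w =>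
    intervalIntegral.integral_congr fun s hs => by
      rw [uIcc_of_le ht.1] at hs
      simp only [hST (t - s) ⟨by linarith [hs.2], by linarith [hs.1, ht.2]⟩]
  rw [e, e, hST t ht]

theorem integrable_inner_map {τ : ℝ} (R : U →L[ℝ] U) (u v : Control τ U) :
    Integrable (fun t => ⟪R (u t), v t⟫_ℝ) (volume.restrict (Ioc (0 : ℝ) τ)) := by
  refine (((Control.integrable_norm_sq u).add (Control.integrable_norm_sq v)).const_mul ‖R‖).mono'
    ((R.continuous.comp_aestronglyMeasurable (Lp.aestronglyMeasurable u)).inner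
      (Lp.aestronglyMeasurable v)) (ae_of_all _ fun t => ?_)
  calc _ ≤ ‖R (u t)‖ * ‖v t‖ := norm_inner_le_norm _ _
    _ ≤ ‖R‖ * ‖u t‖ * ‖v t‖ := by gcongr; exact R.le_opNorm _
    _ = ‖R‖ * (‖u t‖ * ‖v t‖) := by ring
    _ ≤ ‖R‖ * (‖u t‖ ^ 2 + ‖v t‖ ^ 2) := by
        gcongr
        nlinarith [sq_nonneg (‖u t‖ - ‖v t‖), sq_nonneg ‖u t‖, sq_nonneg ‖v t‖]

theorem integrable_inner_map_state (Q : X →L[ℝ] X) {x y : ℝ → X} {τ : ℝ}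
    (hx : ContinuousOn x (Icc 0 τ)) (hy : ContinuousOn y (Icc 0 τ)) :
    Integrable (fun t => ⟪Q (x t), y t⟫_ℝ) (volume.restrict (Ioc (0 : ℝ) τ)) :=
  (((Q.continuous.comp_continuousOn hx).inner hy).integrableOn_Icc).mono_set Ioc_subset_Icc_self

theorem cost_eq {τ : ℝ} (hτ : 0 ≤ τ) (Q : X →L[ℝ] X) (R : U →L[ℝ] U) {x : ℝ → X}
    (hx : ContinuousOn x (Icc 0 τ)) (u : Control τ U) :
    cost Q R x u = (∫ t in Ioc 0 τ, ⟪Q (x t), x t⟫_ℝ) + ∫ t in Ioc 0 τ, ⟪R (u t), u t⟫_ℝ := by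
  rw [cost, intervalIntegral.integral_of_le hτ]
  exact integral_add (integrable_inner_map_state Q hx hx) (integrable_inner_map R u u)

theorem integral_inner_map_add_smul {τ : ℝ} {R : U →L[ℝ] U}
    (hR : ∀ v w, ⟪R v, w⟫_ℝ = ⟪v, R w⟫_ℝ) (u v : Control τ U) (ε : ℝ) :
    ∫ t in Ioc 0 τ, ⟪R ((u + ε • v : Control τ U) t), (u + ε • v : Control τ U) t⟫_ℝ =
      (∫ t in Ioc 0 τ, ⟪R (u t), u t⟫_ℝ) + (2 * ε) * (∫ t in Ioc 0 τ, ⟪R (u t), v t⟫_ℝ) +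
        ε ^ 2 * ∫ t in Ioc 0 τ, ⟪R (v t), v t⟫_ℝ := by
  have i₁ := integrable_inner_map R u u
  have i₂ := (integrable_inner_map R u v).const_mul (2 * ε)
  have i₃ := (integrable_inner_map R v v).const_mul (ε ^ 2)
  have i₄ : Integrable (fun t => ⟪R (u t), u t⟫_ℝ + 2 * ε * ⟪R (u t), v t⟫_ℝ)
    (volume.restrict (Ioc (0 : ℝ) τ)) := i₁.add i₂
  rw [← integral_const_mul, ← integral_const_mul, ← integral_add i₁ i₂, ← integral_add i₄ i₃]
  refine integral_congr_ae ?_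
  filter_upwards [Lp.coeFn_add u (ε • v), Lp.coeFn_smul ε v] with t h1 h2
  rw [h1, Pi.add_apply, h2, Pi.smul_apply]
  simp only [map_add, map_smul, inner_add_left, inner_add_right, inner_smul_left, inner_smul_right]
  rw [hR (v t) (u t), real_inner_comm (R (u t)) (v t)]
  simp only [conj_trivial]
  ring

/-- Exact expansion of the quadratic form about `x₀`, with Cauchy–Schwarz on the remainder; the last
term is `o(ε)` when `δ → 0`. -/
theorem inner_map_le_of_norm_sub_le {Q : X →L[ℝ] X} (hQ : ∀ v w, ⟪Q v, w⟫_ℝ = ⟪v, Q w⟫_ℝ)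
    {x₀ x y : X} {ε δ C Y : ℝ} (hε : 0 ≤ ε) (hC : ‖x₀‖ ≤ C) (hY : ‖y‖ ≤ Y)
    (h : ‖x - x₀ - ε • y‖ ≤ ε * δ) :
    ⟪Q x, x⟫_ℝ ≤ ⟪Q x₀, x₀⟫_ℝ + 2 * ε * ⟪Q x₀, y⟫_ℝ +
      ε * (2 * ‖Q‖ * C * δ + ‖Q‖ * ε * (δ + Y) ^ 2) := by
  set z := x - x₀ - ε • y with hz
  have ex : x = x₀ + (ε • y + z) := by rw [hz]; abel
  have hd : ‖ε • y + z‖ ≤ ε * (δ + Y) := by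
    refine (norm_add_le _ _).trans ?_
    rw [norm_smul, Real.norm_of_nonneg hε]
    nlinarith
  have h1 : ⟪Q x, x⟫_ℝ = ⟪Q x₀, x₀⟫_ℝ + 2 * ε * ⟪Q x₀, y⟫_ℝ + 2 * ⟪Q x₀, z⟫_ℝ +
      ⟪Q (ε • y + z), ε • y + z⟫_ℝ := by
    rw [ex, map_add Q x₀, inner_add_left, inner_add_right, inner_add_right (Q (ε • y + z)),
      hQ (ε • y + z) x₀, real_inner_comm (Q x₀), inner_add_right (Q x₀), inner_smul_right]
    ring
  have h2 : ⟪Q x₀, z⟫_ℝ ≤ ‖Q‖ * C * (ε * δ) :=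
    (real_inner_le_norm _ _).trans (mul_le_mul ((Q.le_opNorm _).trans (by gcongr)) h
      (norm_nonneg _) (mul_nonneg (norm_nonneg _) ((norm_nonneg _).trans hC)))
  have h3 : ⟪Q (ε • y + z), ε • y + z⟫_ℝ ≤ ‖Q‖ * (ε * (δ + Y)) ^ 2 := by
    calc _ ≤ ‖Q (ε • y + z)‖ * ‖ε • y + z‖ := real_inner_le_norm _ _
      _ ≤ (‖Q‖ * ‖ε • y + z‖) * ‖ε • y + z‖ := by gcongr; exact Q.le_opNorm _
      _ = ‖Q‖ * ‖ε • y + z‖ ^ 2 := by ring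
      _ ≤ _ := by gcongr
  rw [h1]
  nlinarith

/-- The Fubini duality, applied to the adjoint source `q = F'*p + Qx₀` and the forcing `F'y + g`,
gives `∫ ⟨q, y⟩ = ∫ ⟨p, F'y + g⟩`. The terms `⟨p, F'y⟩` cancel. -/
theorem IsAdjointState.integral_inner_eq [TopologicalSpace.SeparableSpace X] {T : C0Semigroup X}
    {S : ℝ → X →L[ℝ] X} {M : ℝ} (hM : ∀ t, ‖S t‖ ≤ M) (hS : ∀ x, Continuous fun t => S t x)
    {τ : ℝ} (hST : ∀ t ∈ Icc 0 τ, S t = T.toFun t) {F : X → X} {F' : X → X →L[ℝ] X}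
    (hF : IsGateauxDerivOn F F' univ) (hF' : MapsBoundedToBounded F' univ) {Q : X →L[ℝ] X}
    {x₀ p y g : ℝ → X} (hx₀ : Continuous x₀) (hp : IsAdjointState T F' Q τ x₀ p)
    (hy : Continuous y) (hg : Integrable g (volume.restrict (Ioc 0 τ)))
    (hye : ∀ t ∈ Icc 0 τ, y t = ∫ s in (0 : ℝ)..t, S (t - s) (F' (x₀ s) (y s) + g s)) :
    ∫ t in Ioc 0 τ, ⟪Q (x₀ t), y t⟫_ℝ = ∫ t in Ioc 0 τ, ⟪p t, g t⟫_ℝ := by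
  obtain ⟨hpc, hpe⟩ := hp
  have hpm : AEStronglyMeasurable p (volume.restrict (Ioc (0 : ℝ) τ)) :=
    (hpc.mono Ioc_subset_Icc_self).aestronglyMeasurable measurableSet_Ioc
  obtain ⟨D, hD⟩ := isCompact_Icc.exists_bound_of_continuousOn hpc
  obtain ⟨C, hC0, hC⟩ := exists_norm_le_of_continuous hx₀ τ
  obtain ⟨L, hL0, hL⟩ := hF'.exists_bound C
  let q : ℝ → X := fun t => ContinuousLinearMap.adjoint (F' (x₀ t)) (p t) + Q (x₀ t)
  have hFp : Integrable (fun t => ContinuousLinearMap.adjoint (F' (x₀ t)) (p t))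
      (volume.restrict (Ioc 0 τ)) := by
    refine (integrable_const (L * D)).mono' (aestronglyMeasurable_of_inner fun v => ?_) ?_
    · simp only [ContinuousLinearMap.adjoint_inner_right]
      exact (hF.aestronglyMeasurable_deriv hF' hx₀ continuous_const).inner hpm
    · filter_upwards [ae_restrict_mem measurableSet_Ioc] with t ht
      have ht' := Ioc_subset_Icc_self ht
      refine (ContinuousLinearMap.le_opNorm _ _).trans ?_
      rw [LinearIsometryEquiv.norm_map]
      exact mul_le_mul (hL _ (hC t ht')) (hD t ht') (norm_nonneg _) hL0
  have hq : Integrable q (volume.restrict (Ioc 0 τ)) :=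
    hFp.add ((Q.continuous.comp hx₀).integrableOn_Ioc)
  have hFy := hF.integrable_deriv hF' hx₀ hy τ
  have hw : Integrable (fun s => F' (x₀ s) (y s) + g s) (volume.restrict (Ioc 0 τ)) := hFy.add hg
  have hbdd : ∀ f : ℝ → X, Integrable f (volume.restrict (Ioc 0 τ)) →
      Integrable (fun t => ⟪p t, f t⟫_ℝ) (volume.restrict (Ioc 0 τ)) := by
    intro f hf
    refine (hf.norm.const_mul D).mono' (hpm.inner hf.1) ?_
    filter_upwards [ae_restrict_mem measurableSet_Ioc] with t ht
    exact (norm_inner_le_norm _ _).trans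
      (mul_le_mul_of_nonneg_right (hD t (Ioc_subset_Icc_self ht)) (norm_nonneg _))
  have key := integral_inner_convolution hM hS hq hw
  have hl : ∫ t in Ioc 0 τ, ⟪q t, ∫ s in (0 : ℝ)..t, S (t - s) (F' (x₀ s) (y s) + g s)⟫_ℝ =
      (∫ t in Ioc 0 τ, ⟪p t, F' (x₀ t) (y t)⟫_ℝ) + ∫ t in Ioc 0 τ, ⟪Q (x₀ t), y t⟫_ℝ := by
    rw [← integral_add (hbdd _ hFy)
      (integrable_inner_map_state Q hx₀.continuousOn hy.continuousOn)]
    refine setIntegral_congr_fun measurableSet_Ioc fun t ht => ?_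
    simp only [q]
    rw [← hye t (Ioc_subset_Icc_self ht), inner_add_left, ContinuousLinearMap.adjoint_inner_left]
  have hr : ∫ s in Ioc 0 τ, ⟪∫ t in s..τ, ContinuousLinearMap.adjoint (S (t - s)) (q t),
      F' (x₀ s) (y s) + g s⟫_ℝ =
      (∫ t in Ioc 0 τ, ⟪p t, F' (x₀ t) (y t)⟫_ℝ) + ∫ t in Ioc 0 τ, ⟪p t, g t⟫_ℝ := by
    rw [← integral_add (hbdd _ hFy) (hbdd _ hg)]
    refine setIntegral_congr_fun measurableSet_Ioc fun s hs => ?_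
    have e : ∫ t in s..τ, ContinuousLinearMap.adjoint (S (t - s)) (q t) = p s := by
      rw [hpe s (Ioc_subset_Icc_self hs)]
      refine intervalIntegral.integral_congr fun t ht => ?_
      rw [uIcc_of_le hs.2] at ht
      simp only [hST (t - s) ⟨by linarith [ht.1], by linarith [ht.2, hs.1]⟩, q]
    rw [e, inner_add_right]
  rw [hl, hr] at key
  exact add_left_cancel key

theorem IsAdjointState.congr {T : C0Semigroup X} {F' : X → X →L[ℝ] X} {Q : X →L[ℝ] X} {τ : ℝ}
    {x x' p : ℝ → X} (hp : IsAdjointState T F' Q τ x p) (h : ∀ t ∈ Icc 0 τ, x' t = x t) :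
    IsAdjointState T F' Q τ x' p := by
  refine ⟨hp.1, fun s hs => (hp.2 s hs).trans (intervalIntegral.integral_congr fun t ht => ?_)⟩
  rw [uIcc_of_le hs.2] at ht
  simp only [h t ⟨hs.1.trans ht.1, ht.2⟩]

/-! ### First-order necessary conditions. -/

theorem integrable_map_control {τ : ℝ} (G : U →L[ℝ] X) (u : Control τ U) :
    Integrable (fun t => G (u t)) (volume.restrict (Ioc (0 : ℝ) τ)) :=
  G.integrable_comp (Control.integrable u)

/-- After division by `ε` the error is the operator `(B(r + εh) - B r)/ε - D` applied to `u`, plus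
`B(r + εh) - B r` applied to `v`. Both operators tend to `0` in norm, and `u`, `v` are integrable.
-/
theorem tendsto_forcing {B : K → U →L[ℝ] X} {D : U →L[ℝ] X} {r h : K}
    (hB : HasLineDerivAt ℝ B D r h) {τ : ℝ} (u v : Control τ U) :
    Tendsto (fun ε : ℝ => ε⁻¹ * ∫ s in Ioc 0 τ, ‖B (r + ε • h) ((u + ε • v : Control τ U) s) -
      B r (u s) - ε • (D (u s) + B r (v s))‖) (𝓝[>] 0) (𝓝 0) := by
  have h1 : Tendsto (fun ε : ℝ => ‖ε⁻¹ • (B (r + ε • h) - B r) - D‖) (𝓝[>] 0) (𝓝 0) := by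
    simpa using (hB.tendsto_inv_smul.sub_const D).norm
  have h2 : Tendsto (fun ε : ℝ => ‖B (r + ε • h) - B r‖) (𝓝[>] 0) (𝓝 0) := by
    have h3 : Tendsto (fun ε : ℝ => B (r + ε • h)) (𝓝[>] 0) (𝓝 (B r)) := by
      have := (HasDerivAt.continuousAt hB).tendsto
      simp only [zero_smul, add_zero] at this
      exact this.mono_left nhdsWithin_le_nhds
    simpa using (h3.sub_const (B r)).norm
  have h4 := (h1.mul_const (∫ s in Ioc 0 τ, ‖u s‖)).add (h2.mul_const (∫ s in Ioc 0 τ, ‖v s‖))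
  simp only [zero_mul, add_zero] at h4
  refine squeeze_zero' ?_ ?_ h4
  · filter_upwards [self_mem_nhdsWithin] with ε (hε : 0 < ε)
    exact mul_nonneg (inv_nonneg.2 hε.le) (integral_nonneg fun _ => norm_nonneg _)
  · filter_upwards [self_mem_nhdsWithin] with ε (hε : 0 < ε)
    have i₁ := (Control.integrable u).norm.const_mul ‖ε⁻¹ • (B (r + ε • h) - B r) - D‖
    have i₂ := (Control.integrable v).norm.const_mul ‖B (r + ε • h) - B r‖
    rw [← integral_const_mul, ← integral_const_mul, ← integral_const_mul, ← integral_add i₁ i₂]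
    refine integral_mono_of_nonneg (ae_of_all _ fun s =>
      mul_nonneg (inv_nonneg.2 hε.le) (norm_nonneg _)) (i₁.add i₂) ?_
    filter_upwards [Lp.coeFn_add u (ε • v), Lp.coeFn_smul ε v] with s e1 e2
    rw [e1, Pi.add_apply, e2, Pi.smul_apply]
    have e : ε⁻¹ • (B (r + ε • h) (u s + ε • v s) - B r (u s) - ε • (D (u s) + B r (v s))) =
        (ε⁻¹ • (B (r + ε • h) - B r) - D) (u s) + (B (r + ε • h) - B r) (v s) := by
      simp only [map_add, map_smul, smul_sub, smul_add, smul_smul, inv_mul_cancel₀ hε.ne', one_smul,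
        sub_apply, smul_apply]
      abel
    have e' : ∀ z : X, ε⁻¹ * ‖z‖ = ‖ε⁻¹ • z‖ := fun z => by
      rw [norm_smul, Real.norm_of_nonneg (inv_nonneg.2 hε.le)]
    rw [e', e]
    exact (norm_add_le _ _).trans
      (add_le_add (ContinuousLinearMap.le_opNorm _ _) (ContinuousLinearMap.le_opNorm _ _))

theorem IsLocalMinimizer.variational_inequality [TopologicalSpace.SeparableSpace X]
    {T : C0Semigroup X} {F : X → X} {F' : X → X →L[ℝ] X} (hF : IsGateauxDerivOn F F' univ)
    (hF' : MapsBoundedToBounded F' univ) {Kad : Set K} {B : K → U →L[ℝ] X}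
    {B' : K → K →L[ℝ] (U →L[ℝ] X)} {Q : X →L[ℝ] X} (hQ : ∀ v w, ⟪Q v, w⟫_ℝ = ⟪v, Q w⟫_ℝ)
    {R : U →L[ℝ] U} (hR : ∀ v w, ⟪R v, w⟫_ℝ = ⟪v, R w⟫_ℝ) {τ ρ : ℝ} (hτ : 0 ≤ τ)
    {u₀ : Control τ U} {r₀ : K} (hint : (u₀, r₀) ∈ interior (admissibleControls τ ρ U ×ˢ Kad))
    {ξ : X} {x₀ p : ℝ → X} (hmin : IsLocalMinimizer T F B Q R Kad ρ ξ u₀ r₀ x₀)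
    (hp : IsAdjointState T F' Q τ x₀ p) (v : Control τ U) {h : K}
    (hB : HasLineDerivAt ℝ B (B' r₀ h) r₀ h) :
    0 ≤ (∫ t in Ioc 0 τ, ⟪p t, B' r₀ h (u₀ t) + B r₀ (v t)⟫_ℝ) +
      ∫ t in Ioc 0 τ, ⟪R (u₀ t), v t⟫_ℝ := by
  obtain ⟨-, hmild, hloc⟩ := hmin
  obtain ⟨S, M, hM, hS, hST⟩ := T.exists_extension hτ
  obtain ⟨hx₀c, hx₀e⟩ := (isMildSolution_iff hST).1 hmild
  -- The values of `x₀` outside `[0, τ]` are arbitrary; `x₁` is a globally continuous replacement.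
  obtain ⟨x₁, hx₁c, hx₁⟩ : ∃ x₁ : ℝ → X, Continuous x₁ ∧ ∀ t ∈ Icc 0 τ, x₁ t = x₀ t :=
    ⟨fun t => x₀ (projIcc 0 τ hτ t), hx₀c.comp_continuous
      (continuous_subtype_val.comp continuous_projIcc) fun t => (projIcc 0 τ hτ t).2,
      fun t ht => by simp only [projIcc_of_mem hτ ht]⟩
  have hx₁e : ∀ t ∈ Icc 0 τ, x₁ t = S t ξ + (∫ s in (0 : ℝ)..t, S (t - s) (F (x₁ s))) +
      ∫ s in (0 : ℝ)..t, S (t - s) (B r₀ (u₀ s)) := by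
    intro t ht
    rw [hx₁ t ht, hx₀e t ht]
    congr 2
    refine intervalIntegral.integral_congr fun s hs => ?_
    rw [uIcc_of_le ht.1] at hs
    simp only [hx₁ s ⟨hs.1, hs.2.trans ht.2⟩]
  have hcost : cost Q R x₀ u₀ = cost Q R x₁ u₀ := by
    refine intervalIntegral.integral_congr fun t ht => ?_
    rw [uIcc_of_le hτ] at ht
    simp only [hx₁ t ht]
  have hgi : Integrable (fun t => B' r₀ h (u₀ t) + B r₀ (v t)) (volume.restrict (Ioc 0 τ)) :=
    (integrable_map_control _ u₀).add (integrable_map_control _ v)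
  obtain ⟨y, x, δ, hy, hye, hx, hδ, hev⟩ := exists_perturbed_solution hM hS hτ hF hF'
    (f := fun ε s => B (r₀ + ε • h) ((u₀ + ε • v : Control τ U) s)) (hS ξ).continuousOn hx₁c
    (integrable_map_control (B r₀) u₀) hgi (fun ε => integrable_map_control _ _) hx₁e
    (tendsto_forcing hB u₀ v)
  rw [← (hp.congr hx₁).integral_inner_eq hM hS hST hF hF' hx₁c hy hgi hye]
  obtain ⟨C, hC0, hC⟩ := exists_norm_le_of_continuous hx₁c τ
  obtain ⟨Y, hY0, hY⟩ := exists_norm_le_of_continuous hy τ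
  have hcurve : Tendsto (fun ε : ℝ => (u₀ + ε • v, r₀ + ε • h)) (𝓝[>] 0)
      (𝓝[admissibleControls τ ρ U ×ˢ Kad] (u₀, r₀)) := by
    have h1 : Tendsto (fun ε : ℝ => (u₀ + ε • v, r₀ + ε • h)) (𝓝[>] 0) (𝓝 (u₀, r₀)) := by
      have : Continuous fun ε : ℝ => (u₀ + ε • v, r₀ + ε • h) := by fun_prop
      have := this.tendsto 0
      simp only [zero_smul, add_zero] at this
      exact this.mono_left nhdsWithin_le_nhds
    -- Interiority makes the perturbed pair admissible for small `ε`, whatever the direction `(v,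
    -- h)`.
    exact tendsto_nhdsWithin_iff.2 ⟨h1, h1.eventually (mem_interior_iff_mem_nhds.1 hint)⟩
  set I₁ := ∫ t in Ioc 0 τ, ⟪Q (x₁ t), y t⟫_ℝ
  set I₂ := ∫ t in Ioc 0 τ, ⟪R (u₀ t), v t⟫_ℝ
  set c := ∫ t in Ioc 0 τ, ⟪R (v t), v t⟫_ℝ
  let κ : ℝ → ℝ := fun ε => 2 * ‖Q‖ * C * δ ε + ‖Q‖ * ε * (δ ε + Y) ^ 2
  -- The cost increment is bounded above by `ε` times the right-hand side; the bracket with `κ`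
  -- tends to `0`.
  have hmain : ∀ᶠ ε : ℝ in 𝓝[>] 0, 0 ≤ 2 * (I₁ + I₂) + (κ ε * τ + ε * c) := by
    filter_upwards [hcurve.eventually hloc, hev, self_mem_nhdsWithin] with ε h1 h2 (hε : 0 < ε)
    have h3 := h1 (x ε) ((isMildSolution_iff hST).2 ⟨(hx ε).continuousOn, h2.2⟩)
    rw [hcost, cost_eq hτ Q R hx₁c.continuousOn, cost_eq hτ Q R (hx ε).continuousOn,
      integral_inner_map_add_smul hR] at h3
    have i₁ := integrable_inner_map_state Q (τ := τ) hx₁c.continuousOn hx₁c.continuousOn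
    have i₂ := (integrable_inner_map_state Q (τ := τ) hx₁c.continuousOn hy.continuousOn).const_mul
      (2 * ε)
    have i₃ : Integrable (fun t => ⟪Q (x₁ t), x₁ t⟫_ℝ + 2 * ε * ⟪Q (x₁ t), y t⟫_ℝ)
      (volume.restrict (Ioc 0 τ)) := i₁.add i₂
    have i₄ : Integrable (fun _ : ℝ => ε * κ ε) (volume.restrict (Ioc 0 τ)) := integrable_const _
    have h4 : ∫ t in Ioc 0 τ, ⟪Q (x ε t), x ε t⟫_ℝ ≤
        (∫ t in Ioc 0 τ, ⟪Q (x₁ t), x₁ t⟫_ℝ) + 2 * ε * I₁ + ε * κ ε * τ := by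
      calc _ ≤ ∫ t in Ioc 0 τ, (⟪Q (x₁ t), x₁ t⟫_ℝ + 2 * ε * ⟪Q (x₁ t), y t⟫_ℝ + ε * κ ε) := by
            refine setIntegral_mono_on
              (integrable_inner_map_state Q (hx ε).continuousOn (hx ε).continuousOn) (i₃.add i₄)
              measurableSet_Ioc fun t ht => ?_
            have ht' := Ioc_subset_Icc_self ht
            exact inner_map_le_of_norm_sub_le hQ hε.le (hC t ht') (hY t ht') (h2.1 t ht')
        _ = _ := by
            rw [integral_add i₃ i₄, integral_add i₁ i₂, integral_const_mul]
            simp [hτ, mul_comm, I₁]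
    have h5 : 0 ≤ ε * (2 * (I₁ + I₂) + (κ ε * τ + ε * c)) := by nlinarith
    exact nonneg_of_mul_nonneg_right h5 hε
  have hκ : Tendsto (fun ε => 2 * (I₁ + I₂) + (κ ε * τ + ε * c)) (𝓝[>] 0)
      (𝓝 (2 * (I₁ + I₂))) := by
    have h0 : Tendsto (fun ε : ℝ => ε) (𝓝[>] 0) (𝓝 0) := tendsto_id.mono_left nhdsWithin_le_nhds
    have h1 := (hδ.const_mul (2 * ‖Q‖ * C)).add
      ((h0.const_mul ‖Q‖).mul ((hδ.add_const Y).pow 2))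
    simpa using ((h1.mul_const τ).add (h0.mul_const c)).const_add (2 * (I₁ + I₂))
  have := ge_of_tendsto hκ hmain
  linarith

/-- With `w = B*p + Ru` in `L²`, the direction `v = -w` turns the inequality into `0 ≤ -‖w‖²`. -/
theorem controlCondition_of_inequality {B : K → U →L[ℝ] X} {R : U →L[ℝ] U} (hR : IsPosDef R)
    {τ : ℝ} {u : Control τ U} {r : K} {p : ℝ → X} (hp : ContinuousOn p (Icc 0 τ))
    (h : ∀ v : Control τ U, 0 ≤ (∫ t in Ioc 0 τ, ⟪p t, B r (v t)⟫_ℝ) +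
      ∫ t in Ioc 0 τ, ⟪R (u t), v t⟫_ℝ) : ControlCondition B R u r p := by
  have hq : ContinuousOn (fun t => ContinuousLinearMap.adjoint (B r) (p t)) (Icc 0 τ) :=
    (ContinuousLinearMap.adjoint (B r)).continuous.comp_continuousOn hp
  have hqm : MemLp (fun t => ContinuousLinearMap.adjoint (B r) (p t)) 2
      (volume.restrict (Ioc (0 : ℝ) τ)) := by
    obtain ⟨M, hM⟩ := isCompact_Icc.exists_bound_of_continuousOn hq
    refine MemLp.of_bound ((hq.mono Ioc_subset_Icc_self).aestronglyMeasurable measurableSet_Ioc) M ?_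
    filter_upwards [ae_restrict_mem measurableSet_Ioc] with t ht
    exact hM t (Ioc_subset_Icc_self ht)
  set q : Control τ U := hqm.toLp with hqdef
  set w : Control τ U := q + R.compLp u with hw
  have hwt : ∀ᵐ t ∂(volume.restrict (Ioc 0 τ)),
      w t = ContinuousLinearMap.adjoint (B r) (p t) + R (u t) := by
    filter_upwards [Lp.coeFn_add q (R.compLp u), hqm.coeFn_toLp, R.coeFn_compLp u] with t h1 h2 h3
    rw [hw, h1, Pi.add_apply, hqdef, h2, h3]
  have hpm : AEStronglyMeasurable p (volume.restrict (Ioc (0 : ℝ) τ)) :=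
    (hp.mono Ioc_subset_Icc_self).aestronglyMeasurable measurableSet_Ioc
  have hpi : Integrable (fun t => ⟪p t, B r ((-w : Control τ U) t)⟫_ℝ)
      (volume.restrict (Ioc (0 : ℝ) τ)) := by
    obtain ⟨D, hD⟩ := isCompact_Icc.exists_bound_of_continuousOn hp
    have hi := integrable_map_control (B r) (-w)
    refine (hi.norm.const_mul D).mono' (hpm.inner hi.1) ?_
    filter_upwards [ae_restrict_mem measurableSet_Ioc] with t ht
    exact (norm_inner_le_norm _ _).trans
      (mul_le_mul_of_nonneg_right (hD t (Ioc_subset_Icc_self ht)) (norm_nonneg _))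
  have h1 := h (-w)
  rw [← integral_add hpi (integrable_inner_map R u (-w))] at h1
  have h2 : ∫ t in Ioc 0 τ, (⟪p t, B r ((-w : Control τ U) t)⟫_ℝ +
      ⟪R (u t), (-w : Control τ U) t⟫_ℝ) = -⟪w, w⟫_ℝ := by
    rw [L2.inner_def, ← integral_neg]
    refine integral_congr_ae ?_
    filter_upwards [hwt, Lp.coeFn_neg w] with t e1 e2
    rw [e2, Pi.neg_apply, ← ContinuousLinearMap.adjoint_inner_left, ← inner_add_left, ← e1,
      inner_neg_right]
  rw [h2, real_inner_self_eq_norm_sq] at h1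
  have h3 : w = 0 := by
    have : ‖w‖ = 0 := by nlinarith [norm_nonneg w]
    exact norm_eq_zero.1 this
  filter_upwards [hwt, Lp.coeFn_zero U 2 (volume.restrict (Ioc (0 : ℝ) τ))] with t e1 e2
  rw [h3, e2, Pi.zero_apply] at e1
  rw [eq_comm, ← map_neg, hR.isInvertible.inverse_apply_eq]
  exact (neg_eq_of_add_eq_zero_right e1.symm)

theorem actuatorCondition_of_inequality {B' : K → K →L[ℝ] (U →L[ℝ] X)} {τ : ℝ} (hτ : 0 ≤ τ)
    {u : Control τ U} {r : K} {p : ℝ → X} (hp : ContinuousOn p (Icc 0 τ))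
    (h : ∀ h : K, 0 ≤ ∫ t in Ioc 0 τ, ⟪p t, B' r h (u t)⟫_ℝ) : ActuatorCondition B' u r p := by
  -- The direction opposite to the vector that has to vanish.
  have h1 := h (-∫ t in (0 : ℝ)..τ, ContinuousLinearMap.adjoint ((B' r).flip (u t)) (p t))
  rw [← inner_integral_adjoint_flip hτ _ _ hp, inner_neg_right, real_inner_self_eq_norm_sq] at h1
  rw [ActuatorCondition, ← norm_eq_zero]
  nlinarith [norm_nonneg (∫ t in (0 : ℝ)..τ, ContinuousLinearMap.adjoint ((B' r).flip (u t)) (p t))]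

theorem IsGateauxDerivOn.hasLineDerivAt_of_mem_nhds {B : K → U →L[ℝ] X}
    {B' : K → K →L[ℝ] (U →L[ℝ] X)} {s : Set K} (hB : IsGateauxDerivOn B B' s) {r : K}
    (hr : s ∈ 𝓝 r) (h : K) : HasLineDerivAt ℝ B (B' r h) r h := by
  refine HasDerivWithinAt.hasDerivAt (hB r (mem_of_mem_nhds hr) h) ?_
  have : Continuous fun t : ℝ => r + t • h := by fun_prop
  exact this.continuousAt.preimage_mem_nhds (by simpa using hr)

end ActuatorDesign

end

theorem mainTheorem9
    {X U K : Type*}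
    [NormedAddCommGroup X] [InnerProductSpace ℝ X] [CompleteSpace X]
    [TopologicalSpace.SeparableSpace X]
    [NormedAddCommGroup U] [InnerProductSpace ℝ U] [CompleteSpace U]
    [TopologicalSpace.SeparableSpace U]
    [NormedAddCommGroup K] [InnerProductSpace ℝ K] [CompleteSpace K]
    [TopologicalSpace.SeparableSpace K]
    -- the state operator and the semigroup that it generates
    (A : X →ₗ.[ℝ] X) (T : ActuatorDesign.C0Semigroup X) (hA : ActuatorDesign.IsGenerator A T)
    -- the nonlinearity and its Gâteaux derivative
    (F : X → X) (F' : X → X →L[ℝ] X)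
    (hF : ActuatorDesign.IsGateauxDerivOn F F' Set.univ)
    (hF' : ActuatorDesign.MapsBoundedToBounded F' Set.univ)
    -- the admissible designs, the input operators and their Gâteaux derivative
    (Kad : Set K) (B : K → U →L[ℝ] X) (B' : K → K →L[ℝ] (U →L[ℝ] X))
    (hB : ActuatorDesign.IsGateauxDerivOn B B' Kad)
    (hB' : ActuatorDesign.MapsBoundedToBounded B' Kad)
    -- the weights of the cost
    (Q : X →L[ℝ] X) (hQ : Q.IsPositive)
    (R : U →L[ℝ] U) (hR : ActuatorDesign.IsPosDef R)
    -- the time horizon and the radius of the ball of admissible controls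
    (τ ρ : ℝ) (hτ : 0 < τ) (hρ : 0 < ρ)
    -- orthonormal bases
    {ιX ιU ιK : Type*}
    (eX : HilbertBasis ιX ℝ X) (eU : HilbertBasis ιU ℝ U) (eK : HilbertBasis ιK ℝ K) :
    (∀ r ∈ Kad, ∀ v : U,
      HasSum (fun i => ⟪v, eU i⟫_ℝ • ActuatorDesign.inputVec B eU i r) (B r v)) ∧
    ∀ (u₀ : ActuatorDesign.Control τ U) (r₀ : K),
      (u₀, r₀) ∈ interior (ActuatorDesign.admissibleControls τ ρ U ×ˢ Kad) →
      -- the `b_i` are Gâteaux differentiable at `r₀`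
      (∀ (i : ιU) (h : K),
        HasLineDerivAt ℝ (ActuatorDesign.inputVec B eU i) (B' r₀ h (eU i)) r₀ h) ∧
      -- each optimality condition is equivalent to its form in components
      (∀ p₀ : ℝ → X, ContinuousOn p₀ (Set.Icc 0 τ) →
        (ActuatorDesign.ControlCondition B R u₀ r₀ p₀ ↔
          ActuatorDesign.ControlConditionComponents B R eX eU u₀ r₀ p₀) ∧
        (ActuatorDesign.ActuatorCondition B' u₀ r₀ p₀ ↔
          ActuatorDesign.ActuatorConditionComponents B eX eU eK u₀ r₀ p₀)) ∧
      -- a local minimizer, with its trajectory and adjoint state, satisfies them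
      (∀ (ξ : X) (x₀ p₀ : ℝ → X),
        ActuatorDesign.IsLocalMinimizer T F B Q R Kad ρ ξ u₀ r₀ x₀ →
        ActuatorDesign.IsAdjointState T F' Q τ x₀ p₀ →
        ActuatorDesign.ControlConditionComponents B R eX eU u₀ r₀ p₀ ∧
        ActuatorDesign.ActuatorConditionComponents B eX eU eK u₀ r₀ p₀) := by
  have hUc : Countable ιU := eU.countable_of_separableSpace
  refine ⟨fun r _ v => ActuatorDesign.hasSum_inner_smul_inputVec B eU r v, fun u₀ r₀ hint => ?_⟩
  have hnhds : Kad ∈ nhds r₀ := by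
    have h := mem_interior_iff_mem_nhds.1 hint
    rw [nhds_prod_eq] at h
    exact (Filter.prod_mem_prod_iff.1 h).2
  have hBd := hB.hasLineDerivAt_of_mem_nhds hnhds
  refine ⟨fun i h => ActuatorDesign.hasLineDerivAt_inputVec eU (hBd h) i, fun p₀ hp₀ =>
    ⟨ActuatorDesign.controlCondition_iff_components B hR eX eU u₀ r₀ p₀,
      ActuatorDesign.actuatorCondition_iff_components eX eU eK hτ.le u₀ hBd hp₀⟩,
    fun ξ x₀ p₀ hmin hp => ?_⟩
  have hvar := fun v h => hmin.variational_inequality hF hF' (B' := B')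
    (fun v w => hQ.isSelfAdjoint.isSymmetric v w) hR.inner_map hτ.le hint hp v (hBd h)
  rw [← ActuatorDesign.controlCondition_iff_components B hR eX eU u₀ r₀ p₀,
    ← ActuatorDesign.actuatorCondition_iff_components eX eU eK hτ.le u₀ hBd hp.1]
  -- The two conditions decouple: `h = 0` isolates the variation of the control, `v = 0` that of the
  -- design.
  refine ⟨ActuatorDesign.controlCondition_of_inequality hR hp.1 fun v => ?_,
    ActuatorDesign.actuatorCondition_of_inequality hτ.le hp.1 fun h => ?_⟩
  · simpa using hvar v 0
  · have h0 := hvar 0 h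
    have e1 : ∫ t in Set.Ioc 0 τ,
        ⟪p₀ t, B' r₀ h (u₀ t) + B r₀ ((0 : ActuatorDesign.Control τ U) t)⟫_ℝ =
        ∫ t in Set.Ioc 0 τ, ⟪p₀ t, B' r₀ h (u₀ t)⟫_ℝ := by
      refine MeasureTheory.integral_congr_ae ?_
      filter_upwards [MeasureTheory.Lp.coeFn_zero U 2
        (MeasureTheory.volume.restrict (Set.Ioc (0 : ℝ) τ))] with t ht
      simp only [ht, Pi.zero_apply, map_zero, add_zero]
    have e2 : ∫ t in Set.Ioc 0 τ, ⟪R (u₀ t), (0 : ActuatorDesign.Control τ U) t⟫_ℝ = 0 := by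
      refine (MeasureTheory.integral_congr_ae ?_).trans (MeasureTheory.integral_zero ℝ ℝ)
      filter_upwards [MeasureTheory.Lp.coeFn_zero U 2
        (MeasureTheory.volume.restrict (Set.Ioc (0 : ℝ) τ))] with t ht
      simp only [ht, Pi.zero_apply, inner_zero_right]
    rwa [e1, e2, add_zero] at h0
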